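/- Conventions. Let $S_n$ be the group of permutations of $\{1,\dots,n\}$ with product $\sigma\cdot\tau=\tau\circ\sigma$. The symmetric groups operad $\mathscr S=\{S_n\}_{n\ge 0}$ has the composition $\gamma(\sigma;\tau_1,\dots,\tau_k)$ that sends the $j$-th letter of the $i$-th block (of size $m_i$) to the $\tau_i(j)$-th letter of the $\sigma(i)$-th block. A *group operad* $\mathscr G=\{G_n\}_{n\ge0}$ is a sequence of groups, with $G_0$ trivial, with homomorphisms $\pi:G_n\to S_n$ and compositions $\gamma:G_k\times G_{m_1}\times\dots\times G_{m_k}\to G_{m_1+\dots+m_k}$ that form an operad (associative, with the identity $e_1\in G_1$ as unit), such that $\pi$ is a morphism of operads and $$\gamma(aa';b_1b_1',\dots,b_kb_k')=\gamma(a;b_1,\dots,b_k)\,\gamma(a';b'_{a^{-1}(1)},\dots,b'_{a^{-1}(k)}),\qquad a(i):=\pi(a)(i).$$ A morphism of group operads is a sequence of group homomorphisms commuting with $\pi$ and $\gamma$. A sub group operad $\mathscr H=\{H_n\}\le\mathscr G$ is a sequence of subgroups $H_n\le G_n$ closed under $\gamma$; a morphism of pairs $(\mathscr G,\mathscr H)\to(\mathscr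 G',\mathscr H')$ is a morphism $\psi:\mathscr G\to\mathscr G'$ with $\psi(H_n)\subseteq H_n'$ for all $n$. For a group $G$ let $EG$ be the simplicial set with $(EG)_l=G^{l+1}$, whose faces delete and whose degeneracies repeat entries, with the left action $b\cdot(a_0,\dots,a_l)=(ba_0,\dots,ba_l)$ of $G$. For $H\le G$ let $EG/H$ be the quotient by the action of $H$, based at the vertex $H(e)$, and let $|EG|/H$ be the quotient space of the geometric realization, based at the image of the vertex $e$. The group $\pi_1(EG/H)$ consists of the homotopy classes of spherical $1$-simplices (both faces are the base point), with $[d_2s]\cdot[d_0s]=[d_1s]$ for every $2$-simplex $s$ whose faces are spherical; $\pi_1(|EG|/H)$ is the usual fundamental group, with $[f][g]$ the class of $f$ followed by $g$. The composition of $E\mathscr G=\{EG_n\}$ is $\gamma$ applied entrywise, and that of $|E\mathscr G|=\{|EG_n|\}$ is its realization, $([c;t],[a_1;t],\dots,[a_k;t])\mapsto[\gamma(c;a_1,\dots,a_k);t]$. Let $e_n$ denote also the vertex $e_n$ of $EG_n$ and of $|EG_n|$. For a sub group operad $\mathscr H\le\mathscr G$, the fundamental groups operad $\pi_1(|E\mathscr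 G|/\mathscr H)=\{\pi_1(|EG_n|/H_n)\}_{n\ge 0}$ has the following structure. A class $x\in\pi_1(|EG_n|/H_n)$ is represented by the projection of a path $f$ in $|EG_n|$ from $e_n$ to $a e_n$ with $a\in H_n$; put $\pi(x)=\pi(a)$. If $x$ (in arity $k$) and $y_i$ (in arity $m_i$) are represented by such paths $f$, from $e_k$ to $ae_k$, and $g_i$, from $e_{m_i}$ to $b_ie_{m_i}$, then $\gamma(x;y_1,\dots,y_k)$ is represented by the path $s\mapsto\gamma(f(s);g_1(s),\dots,g_k(s))$ from $e_m$ to $\gamma(a;b_1,\dots,b_k)e_m$, $m=m_1+\dots+m_k$. The fundamental groups operad $\pi_1(E\mathscr G/\mathscr H)=\{\pi_1(EG_n/H_n)\}_{n\ge0}$ is defined in the same way, with $1$-simplices of $EG_n$ from $e_n$ to $ae_n$ in place of paths. **Theorem.** For every group operad $\mathscr G$ and every sub group operad $\mathscr H\le\mathscr G$, these prescriptions define group operads $\pi_1(E\mathscr G/\mathscr H)$ and $\pi_1(|E\mathscr G|/\mathscr H)$ (in particular the composite paths are continuous), and there are isomorphisms of group operads $$\mathscr H\;\cong\;\pi_1(E\mathscr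 G/\mathscr H)\;\cong\;\pi_1(|E\mathscr G|/\mathscr H)$$ that are natural with respect to morphisms of pairs of group operads. In particular, $\mathscr G\cong\pi_1(E\mathscr G/\mathscr G)\cong\pi_1(|E\mathscr G|/\mathscr G)$ as group operads. -/

import Mathlib

universe u

/-! ## Group operads -/

/-- The symmetric group of `{1, …, n}` with the product `σ · τ = τ ∘ σ` ("first `σ`, then `τ`"). -/
abbrev SymGroup (n : ℕ) : Type := (Equiv.Perm (Fin n))ᵐᵒᵖ

/-- The block of sizes `m 0, m 1, …` (of total size `N`) containing a position `l < N`, together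
with the position inside this block. -/
def blockOf {k : ℕ} (m : Fin k → ℕ) {N : ℕ} (h : ∑ i, m i = N) (l : Fin N) :
    (i : Fin k) × Fin (m i) :=
  finSigmaFinEquiv.symm (Fin.cast h.symm l)

lemma sum_comp_perm {k : ℕ} {m : Fin k → ℕ} {N : ℕ} (h : ∑ i, m i = N)
    (p : Equiv.Perm (Fin k)) : ∑ i, m (p i) = N :=
  (Equiv.sum_comp p m).trans h

/-- The composition `γ(p; q₁, …, q_k)` of the symmetric groups operad: the `j`-th letter of the
`i`-th block (of size `m i`) goes to the `q_i(j)`-th letter of the `p(i)`-th block of the target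
(the blocks of the target have the sizes `m (p⁻¹ 0), m (p⁻¹ 1), …`). -/
def SymGroup.γ {k : ℕ} (m : Fin k → ℕ) {N : ℕ} (h : ∑ i, m i = N) (p : SymGroup k)
    (q : ∀ i, SymGroup (m i)) : SymGroup N :=
  MulOpposite.op <|
    (finCongr h.symm).trans <|
    finSigmaFinEquiv.symm.trans <|
    (Equiv.sigmaCongrRight fun i => (q i).unop).trans <|
    (Equiv.sigmaCongrLeft' p.unop).trans <|
    finSigmaFinEquiv.trans <|
    finCongr (sum_comp_perm h p.unop.symm)

/-- A group operad whose `n`-th group is `G n`. In `γ m h a b`, the argument `h : ∑ i, m i = N`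
records that the result has arity `N`. (For `k = 0` the operation `γ` is `G 0 → G 0`, which carries
no information since `G 0` is trivial.) -/
structure GroupOperad (G : ℕ → Type*) [∀ n, Group (G n)] where
  /-- `G 0` is a point. -/
  subsingleton_zero : Subsingleton (G 0)
  /-- The homomorphisms to the symmetric groups. -/
  π : ∀ n, G n →* SymGroup n
  /-- The operad composition. -/
  γ : ∀ {k : ℕ} (m : Fin k → ℕ) {N : ℕ}, ∑ i, m i = N → G k → (∀ i, G (m i)) → G N
  assoc : ∀ {k : ℕ} (m : Fin k → ℕ) {M : ℕ} (hm : ∑ i, m i = M)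
    (n : ∀ i, Fin (m i) → ℕ) (n' : Fin k → ℕ) (hn : ∀ i, ∑ j, n i j = n' i)
    {N : ℕ} (hn' : ∑ i, n' i = N)
    (hN : ∑ l : Fin M, n (blockOf m hm l).1 (blockOf m hm l).2 = N)
    (a : G k) (b : ∀ i, G (m i)) (c : ∀ i j, G (n i j)),
    γ (fun l : Fin M => n (blockOf m hm l).1 (blockOf m hm l).2) hN (γ m hm a b)
        (fun l => c (blockOf m hm l).1 (blockOf m hm l).2) =
      γ n' hn' a (fun i => γ (n i) (hn i) (b i) (c i))
  one_γ : ∀ {n : ℕ} (h : ∑ _i : Fin 1, n = n) (a : G n), γ (fun _ => n) h 1 (fun _ => a) = a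
  γ_one : ∀ {n : ℕ} (h : ∑ _i : Fin n, 1 = n) (a : G n), γ (fun _ => 1) h a (fun _ => 1) = a
  /-- `π` is a morphism of operads. -/
  π_γ : ∀ {k : ℕ} (m : Fin k → ℕ) {N : ℕ} (h : ∑ i, m i = N) (a : G k) (b : ∀ i, G (m i)),
    π N (γ m h a b) = SymGroup.γ m h (π k a) (fun i => π (m i) (b i))
  /-- `γ` is a crossed homomorphism:
  `γ(aa'; b₁b₁', …, b_kb_k') = γ(a; b₁, …, b_k) γ(a'; b'_{a⁻¹(1)}, …, b'_{a⁻¹(k)})`. -/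
  crossed : ∀ {k : ℕ} (m : Fin k → ℕ) {N : ℕ} (h : ∑ i, m i = N) (a a' : G k)
    (b b' : ∀ i, G (m i)),
    γ m h (a * a') (fun i => b i * b' i) =
      γ m h a b *
        γ (fun i => m ((π k a).unop.symm i)) (sum_comp_perm h (π k a).unop.symm) a'
          (fun i => b' ((π k a).unop.symm i))

/-- Morphisms of group operads. -/
structure GroupOperad.Hom {G : ℕ → Type*} [∀ n, Group (G n)] (𝒢 : GroupOperad G)
    {G' : ℕ → Type*} [∀ n, Group (G' n)] (𝒢' : GroupOperad G') where
  app : ∀ n, G n →* G' n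
  map_π : ∀ n (a : G n), 𝒢'.π n (app n a) = 𝒢.π n a
  map_γ : ∀ {k : ℕ} (m : Fin k → ℕ) {N : ℕ} (h : ∑ i, m i = N) (a : G k) (b : ∀ i, G (m i)),
    app N (𝒢.γ m h a b) = 𝒢'.γ m h (app k a) (fun i => app (m i) (b i))

/-- Isomorphisms of group operads: morphisms that are bijective in each arity. -/
structure GroupOperad.Iso {G : ℕ → Type*} [∀ n, Group (G n)] (𝒢 : GroupOperad G)
    {G' : ℕ → Type*} [∀ n, Group (G' n)] (𝒢' : GroupOperad G') extends GroupOperad.Hom 𝒢 𝒢' where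
  bijective : ∀ n, Function.Bijective (app n)

/-- Sub group operads. -/
structure SubGroupOperad {G : ℕ → Type*} [∀ n, Group (G n)] (𝒢 : GroupOperad G) where
  H : ∀ n, Subgroup (G n)
  γ_mem : ∀ {k : ℕ} (m : Fin k → ℕ) {N : ℕ} (h : ∑ i, m i = N) {a : G k} {b : ∀ i, G (m i)},
    a ∈ H k → (∀ i, b i ∈ H (m i)) → 𝒢.γ m h a b ∈ H N

namespace SubGroupOperad

variable {G : ℕ → Type*} [∀ n, Group (G n)] {𝒢 : GroupOperad G}

/-- A sub group operad is a group operad with the restrictions of `π` and `γ`. -/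
def toGroupOperad (𝓗 : SubGroupOperad 𝒢) : GroupOperad (fun n => 𝓗.H n) where
  subsingleton_zero := by
    have := 𝒢.subsingleton_zero
    infer_instance
  π n := (𝒢.π n).comp (𝓗.H n).subtype
  γ m _ h a b := ⟨𝒢.γ m h a.1 (fun i => (b i).1), 𝓗.γ_mem m h a.2 (fun i => (b i).2)⟩
  assoc m _ hm n n' hn _ hn' hN a b c :=
    Subtype.ext (𝒢.assoc m hm n n' hn hn' hN a.1 (fun i => (b i).1) (fun i j => (c i j).1))
  one_γ h a := Subtype.ext (𝒢.one_γ h a.1)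
  γ_one h a := Subtype.ext (𝒢.γ_one h a.1)
  π_γ m _ h a b := 𝒢.π_γ m h a.1 (fun i => (b i).1)
  crossed m _ h a a' b b' :=
    Subtype.ext (𝒢.crossed m h a.1 a'.1 (fun i => (b i).1) (fun i => (b' i).1))

/-- `𝒢` as a sub group operad of itself. -/
def whole (𝒢 : GroupOperad G) : SubGroupOperad 𝒢 where
  H _ := ⊤
  γ_mem _ _ _ _ _ _ _ := Subgroup.mem_top _

end SubGroupOperad

/-- `ψ` is a morphism of pairs `(𝒢, 𝓗) → (𝒢', 𝓗')`. -/
def GroupOperad.Hom.MapsPair {G : ℕ → Type*} [∀ n, Group (G n)] {𝒢 : GroupOperad G}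
    {G' : ℕ → Type*} [∀ n, Group (G' n)] {𝒢' : GroupOperad G'} (ψ : GroupOperad.Hom 𝒢 𝒢')
    (𝓗 : SubGroupOperad 𝒢) (𝓗' : SubGroupOperad 𝒢') : Prop :=
  ∀ n, ∀ a ∈ 𝓗.H n, ψ.app n a ∈ 𝓗'.H n

section Homotopy

open CategoryTheory Simplicial
open scoped unitInterval

/-! ## The fundamental group of a pointed simplicial set -/

namespace SSet

variable {X Y : SSet.{u}}

/-- Homotopy of spherical `1`-simplices (edges both of whose faces are the base point). -/
def LoopHomotopic {x : X _⦋0⦌} (e f : X.Edge x x) : Prop :=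
  Nonempty (Edge.CompStruct e (Edge.id x) f)

/-- The set of homotopy classes of spherical `1`-simplices. -/
def LoopClasses (X : SSet.{u}) (x : X _⦋0⦌) : Type u :=
  Quot (LoopHomotopic (x := x))

/-- The relation `w = u v` on homotopy classes of spherical `1`-simplices: there is a `2`-simplex
whose faces `d₂`, `d₀`, `d₁` represent `u`, `v`, `w`. -/
def LoopClasses.IsProduct {x : X _⦋0⦌} (u v w : LoopClasses X x) : Prop :=
  ∃ e f g : X.Edge x x, Quot.mk _ e = u ∧ Quot.mk _ f = v ∧ Quot.mk _ g = w ∧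
    Nonempty (Edge.CompStruct e f g)

/-- The map induced by a pointed simplicial map. -/
def LoopClasses.map (φ : X ⟶ Y) {x : X _⦋0⦌} {y : Y _⦋0⦌} (h : φ.app _ x = y) :
    LoopClasses X x → LoopClasses Y y :=
  Quot.map (fun e => (e.map φ).ofEq h h) (by
    subst h
    rintro e f ⟨s⟩
    refine ⟨Edge.CompStruct.mk (s.map φ).simplex ?_ ?_ ?_⟩
    · exact (s.map φ).d₂
    · exact (s.map φ).d₀.trans (congrArg Edge.edge (Edge.map_id x φ))
    · exact (s.map φ).d₁)

end SSet

/-! ## The simplicial set `EG` and its quotients -/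

section EG

variable (G : Type u) [Group G]

/-- The simplicial set `EG`, with `(EG)_k = G^{k+1}`. -/
def EG : SSet.{u} where
  obj n := Fin (n.unop.len + 1) → G
  map f := ↾fun s => s ∘ f.unop.toOrderHom
  map_id _ := rfl
  map_comp _ _ := rfl

/-- The vertex `e` of `EG`. -/
def EG.base : (EG G) _⦋0⦌ := fun _ : Fin 1 => (1 : G)

variable {G}

/-- The map `EG → EG'` induced by a homomorphism. -/
def EG.map {G' : Type u} [Group G'] (φ : G →* G') : EG G ⟶ EG G' where
  app n := ↾fun (s : Fin (n.unop.len + 1) → G) => fun i => φ (s i)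
  naturality _ _ _ := rfl

/-- The action `g · (a₀, …, a_k) = (g a₀, …, g a_k)` on `EG`. -/
def EG.smul (g : G) : EG G ⟶ EG G where
  app n := ↾fun (s : Fin (n.unop.len + 1) → G) => fun i => g * s i
  naturality _ _ _ := rfl

/-- The quotient `EG/H` modulo the left action of `H`. -/
def EGmod (H : Subgroup G) : SSet.{u} where
  obj n := Quotient (MulAction.orbitRel H (Fin (n.unop.len + 1) → G))
  map f := ↾Quotient.map' (fun s => s ∘ f.unop.toOrderHom) (by
    rintro _ s ⟨h, rfl⟩
    exact ⟨h, rfl⟩)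
  map_id n := by
    ext s
    induction s using Quotient.inductionOn
    rfl
  map_comp f g := by
    ext s
    induction s using Quotient.inductionOn
    rfl

/-- The projection `EG → EG/H`. -/
def EGmod.proj (H : Subgroup G) : EG G ⟶ EGmod H where
  app n := ↾fun (s : Fin (n.unop.len + 1) → G) =>
    (Quotient.mk (MulAction.orbitRel H (Fin (n.unop.len + 1) → G)) s)
  naturality _ _ _ := rfl

/-- The base point `H(e)` of `EG/H`. -/
def EGmod.base (H : Subgroup G) : (EGmod H) _⦋0⦌ := (EGmod.proj H).app _ (EG.base G)

/-- The map `EG/H → EG'/H'` induced by a homomorphism of pairs of groups. -/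
def EGmod.map {G' : Type u} [Group G'] {H : Subgroup G} {H' : Subgroup G'} (φ : G →* G')
    (hφ : ∀ a ∈ H, φ a ∈ H') : EGmod H ⟶ EGmod H' where
  app n := ↾Quotient.map' (fun (s : Fin (n.unop.len + 1) → G) => fun i => φ (s i)) (by
    rintro _ s ⟨h, rfl⟩
    exact ⟨⟨φ h, hφ h h.2⟩, by ext i; exact (map_mul φ (h : G) (s i)).symm⟩)
  naturality n m f := by
    ext s
    induction s using Quotient.inductionOn
    rfl

lemma EGmod.map_base {G' : Type u} [Group G'] {H : Subgroup G} {H' : Subgroup G'} (φ : G →* G')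
    (hφ : ∀ a ∈ H, φ a ∈ H') : (EGmod.map φ hφ).app _ (EGmod.base H) = EGmod.base H' :=
  congrArg (Quotient.mk (MulAction.orbitRel H' (Fin 1 → G'))) (funext fun _ => map_one φ)

lemma EGmod.proj_smul_base (H : Subgroup G) (a : H) :
    (EGmod.proj H).app _ ((EG.smul (a : G)).app _ (EG.base G)) = EGmod.base H :=
  Quotient.sound (s := MulAction.orbitRel H (Fin 1 → G)) ⟨a, rfl⟩

/-- The fundamental group `π₁(EG/H)` of the (Kan) simplicial set `EG/H`. -/
abbrev SimplicialPi1 (H : Subgroup G) : Type u := (EGmod H).LoopClasses (EGmod.base H)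

end EG

section SimplicialPi1Group

variable {G : Type u} [Group G] (H : Subgroup G)

namespace SimplicialPi1

/-- The invariant `a⁻¹ b` of a `1`-simplex `H(a, b)` of `EG/H`. -/
def label : (EGmod H) _⦋1⦌ → G :=
  Quotient.lift (s := MulAction.orbitRel H (Fin 2 → G)) (fun s => (s 0)⁻¹ * s 1) (by
    rintro _ s ⟨h, rfl⟩
    change ((h : G) * s 0)⁻¹ * ((h : G) * s 1) = _
    group)

variable {H}

lemma label_mul {e f g : (EGmod H).Edge (EGmod.base H) (EGmod.base H)}
    (c : SSet.Edge.CompStruct e f g) :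
    label H g.edge = label H e.edge * label H f.edge := by
  rw [← c.d₀, ← c.d₁, ← c.d₂]
  obtain ⟨s, hs⟩ := Quotient.exists_rep (s := MulAction.orbitRel H (Fin 3 → G)) c.simplex
  rw [← hs]
  change (s 0)⁻¹ * s 2 = ((s 0)⁻¹ * s 1) * ((s 1)⁻¹ * s 2)
  group

lemma label_id : label H (SSet.Edge.id (EGmod.base H)).edge = 1 := by
  change (1 : G)⁻¹ * 1 = 1
  simp

lemma exists_edge {a : G} (ha : a ∈ H) :
    ∃ e : (EGmod H).Edge (EGmod.base H) (EGmod.base H), label H e.edge = a := by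
  refine ⟨SSet.Edge.mk (Quotient.mk (MulAction.orbitRel H (Fin 2 → G)) ![1, a]) ?_ ?_, ?_⟩
  · refine congrArg (Quotient.mk (MulAction.orbitRel H (Fin 1 → G))) ?_
    funext i
    fin_cases i
    rfl
  · refine Quotient.sound (s := MulAction.orbitRel H (Fin 1 → G)) ⟨⟨a, ha⟩, ?_⟩
    funext i
    fin_cases i
    exact mul_one a
  · change (1 : G)⁻¹ * a = a
    simp

lemma exists_rep (e : (EGmod H).Edge (EGmod.base H) (EGmod.base H)) :
    label H e.edge ∈ H ∧
      e.edge = Quotient.mk (MulAction.orbitRel H (Fin 2 → G)) ![1, label H e.edge] := by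
  have h0 := e.src_eq
  have h1 := e.tgt_eq
  generalize e.edge = x at h0 h1 ⊢
  obtain ⟨s, rfl⟩ := Quotient.exists_rep (s := MulAction.orbitRel H (Fin 2 → G)) x
  obtain ⟨a, ha⟩ := Quotient.exact (s := MulAction.orbitRel H (Fin 1 → G)) h0
  obtain ⟨b, hb⟩ := Quotient.exact (s := MulAction.orbitRel H (Fin 1 → G)) h1
  have ha' : (a : G) * 1 = s 0 := congrFun ha 0
  have hb' : (b : G) * 1 = s 1 := congrFun hb 0
  rw [mul_one] at ha' hb'
  refine ⟨?_, Quotient.sound (s := MulAction.orbitRel H (Fin 2 → G)) ⟨a, ?_⟩⟩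
  · change (s 0)⁻¹ * s 1 ∈ H
    rw [← ha', ← hb']
    exact H.mul_mem (H.inv_mem a.2) b.2
  · funext i
    fin_cases i
    · change (a : G) * 1 = s 0
      rw [mul_one, ha']
    · change (a : G) * ((s 0)⁻¹ * s 1) = s 1
      rw [ha']
      group

lemma edge_ext {e f : (EGmod H).Edge (EGmod.base H) (EGmod.base H)}
    (h : label H e.edge = label H f.edge) : e = f :=
  SSet.Edge.ext (by rw [(exists_rep e).2, (exists_rep f).2, h])

lemma exists_compStruct {e f g : (EGmod H).Edge (EGmod.base H) (EGmod.base H)}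
    (h : label H g.edge = label H e.edge * label H f.edge) :
    Nonempty (SSet.Edge.CompStruct e f g) := by
  obtain ⟨he, he'⟩ := exists_rep e
  obtain ⟨hf, hf'⟩ := exists_rep f
  obtain ⟨hg, hg'⟩ := exists_rep g
  refine ⟨SSet.Edge.CompStruct.mk (Quotient.mk (MulAction.orbitRel H (Fin 3 → G))
    ![1, label H e.edge, label H g.edge]) ?_ ?_ ?_⟩
  · refine Eq.trans (congrArg (Quotient.mk (MulAction.orbitRel H (Fin 2 → G))) ?_) he'.symm
    funext i
    fin_cases i <;> rfl
  · refine Eq.trans (Quotient.sound (s := MulAction.orbitRel H (Fin 2 → G)) ⟨⟨_, he⟩, ?_⟩) hf'.symm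
    funext i
    fin_cases i
    · exact mul_one _
    · exact h.symm
  · refine Eq.trans (congrArg (Quotient.mk (MulAction.orbitRel H (Fin 2 → G))) ?_) hg'.symm
    funext i
    fin_cases i <;> rfl

variable (H) in
/-- The invariant of a homotopy class. -/
def classLabel : SimplicialPi1 H → G :=
  Quot.lift (fun e => label H e.edge) (by
    rintro e f ⟨c⟩
    have h := label_mul c
    rw [label_id, mul_one] at h
    exact h.symm)

lemma classLabel_injective : Function.Injective (classLabel H) := by
  rintro ⟨e⟩ ⟨f⟩ h
  exact congrArg (Quot.mk _) (edge_ext h)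

lemma classLabel_mem (u : SimplicialPi1 H) : classLabel H u ∈ H := by
  obtain ⟨e⟩ := u
  exact (exists_rep e).1

lemma exists_class {a : G} (ha : a ∈ H) : ∃ u : SimplicialPi1 H, classLabel H u = a := by
  obtain ⟨e, he⟩ := exists_edge ha
  exact ⟨Quot.mk _ e, he⟩

lemma isProduct_iff {u v w : SimplicialPi1 H} :
    SSet.LoopClasses.IsProduct u v w ↔ classLabel H w = classLabel H u * classLabel H v := by
  constructor
  · rintro ⟨e, f, g, rfl, rfl, rfl, ⟨c⟩⟩
    exact label_mul c
  · intro h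
    obtain ⟨e⟩ := u
    obtain ⟨f⟩ := v
    obtain ⟨g⟩ := w
    exact ⟨e, f, g, rfl, rfl, rfl, exists_compStruct h⟩

lemma existsUnique_product (u v : SimplicialPi1 H) :
    ∃! w, SSet.LoopClasses.IsProduct u v w := by
  obtain ⟨w, hw⟩ := exists_class (H.mul_mem (classLabel_mem u) (classLabel_mem v))
  exact ⟨w, isProduct_iff.2 hw, fun w' h => classLabel_injective
    ((isProduct_iff.1 h).trans hw.symm)⟩

lemma exists_leftInverse (u : SimplicialPi1 H) :
    ∃ v, SSet.LoopClasses.IsProduct v u (Quot.mk _ (SSet.Edge.id (EGmod.base H))) := by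
  obtain ⟨v, hv⟩ := exists_class (H.inv_mem (classLabel_mem u))
  refine ⟨v, isProduct_iff.2 ?_⟩
  rw [hv, inv_mul_cancel]
  exact label_id (H := H)

/-- The product in `π₁(EG/H)`: `[d₂ s] · [d₀ s] = [d₁ s]` for every `2`-simplex `s` of `EG/H` with
spherical faces. -/
noncomputable instance : Mul (SimplicialPi1 H) := ⟨fun u v => (existsUnique_product u v).choose⟩

/-- The unit is the class of the degenerate `1`-simplex at the base point. -/
instance : One (SimplicialPi1 H) := ⟨Quot.mk _ (SSet.Edge.id (EGmod.base H))⟩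

noncomputable instance : Inv (SimplicialPi1 H) := ⟨fun u => (exists_leftInverse u).choose⟩

lemma classLabel_mul (u v : SimplicialPi1 H) :
    classLabel H (u * v) = classLabel H u * classLabel H v :=
  isProduct_iff.1 (existsUnique_product u v).choose_spec.1

lemma classLabel_inv_mul (u : SimplicialPi1 H) : u⁻¹ * u = 1 :=
  classLabel_injective ((classLabel_mul _ _).trans
    (isProduct_iff.1 (exists_leftInverse u).choose_spec).symm)

noncomputable instance : Group (SimplicialPi1 H) :=
  Group.ofLeftAxioms
    (fun u v w => classLabel_injective (by simp only [classLabel_mul, mul_assoc]))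
    (fun u => classLabel_injective (by
      rw [classLabel_mul, show classLabel H 1 = 1 from label_id (H := H), one_mul]))
    classLabel_inv_mul

end SimplicialPi1

variable {H}

/-- A `1`-simplex of `EG` from `e` to `a e`, with `a ∈ H`, projects to a spherical `1`-simplex of
`EG/H`; this is its class in `π₁(EG/H)`. -/
def SimplicialPi1.ofLift (a : H)
    (f : (EG G).Edge (EG.base G) ((EG.smul (a : G)).app _ (EG.base G))) : SimplicialPi1 H :=
  Quot.mk _ ((f.map (EGmod.proj H)).ofEq rfl (EGmod.proj_smul_base H a))

end SimplicialPi1Group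

/-! ## The realization `|EG|` and its quotients -/

section Realization

/-- The point `[s; t]` of the geometric realization of a simplicial set, for an `n`-simplex `s` and
a point `t` of the topological `n`-simplex. -/
noncomputable def SSet.point {X : SSet.{u}} {n : ℕ} (s : X _⦋n⦌)
    (t : _root_.stdSimplex ℝ (Fin (n + 1))) : SSet.toTop.obj X :=
  TopCat.toSSetObjEquiv (SSet.toTop.obj X) (Opposite.op ⦋n⦌)
    ((sSetTopAdj.unit.app X).app (Opposite.op ⦋n⦌) s) t

variable (G : Type u) [Group G]

/-- The geometric realization `|EG|`. -/
noncomputable abbrev RealE : TopCat.{u} := SSet.toTop.obj (EG G)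

/-- The vertex `e` of `|EG|`. -/
noncomputable def RealE.base : RealE G := SSet.point (n := 0) (EG.base G) (_root_.stdSimplex.vertex 0)

variable {G}

/-- The action of `G` on `|EG|`. -/
noncomputable instance RealE.mulAction : MulAction G (RealE G) where
  smul g p := SSet.toTop.map (EG.smul g) p
  one_smul p := by
    change SSet.toTop.map (EG.smul (1 : G)) p = p
    have h : EG.smul (1 : G) = 𝟙 (EG G) := by
      ext n s
      exact funext fun i => one_mul (s i)
    rw [h, SSet.toTop.map_id]
    rfl
  mul_smul g g' p := by
    change SSet.toTop.map (EG.smul (g * g')) p =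
      SSet.toTop.map (EG.smul g) (SSet.toTop.map (EG.smul g') p)
    have h : EG.smul (g * g') = EG.smul g' ≫ EG.smul g := by
      ext n s
      exact funext fun i => mul_assoc g g' (s i)
    rw [h, SSet.toTop.map_comp]
    rfl

/-- The quotient space `|EG|/H`. -/
abbrev RealEmod (H : Subgroup G) : Type u := Quotient (MulAction.orbitRel H (RealE G))

/-- The projection `|EG| → |EG|/H`. -/
noncomputable def RealEmod.proj (H : Subgroup G) : C(RealE G, RealEmod H) :=
  ⟨Quotient.mk (MulAction.orbitRel H (RealE G)), continuous_quotient_mk'⟩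

/-- The base point of `|EG|/H`. -/
noncomputable def RealEmod.base (H : Subgroup G) : RealEmod H := RealEmod.proj H (RealE.base G)

lemma RealEmod.proj_smul_base (H : Subgroup G) (a : H) :
    RealEmod.base H = RealEmod.proj H ((a : G) • RealE.base G) :=
  (Quotient.sound (s := MulAction.orbitRel H (RealE G)) ⟨a, rfl⟩).symm

lemma RealE.map_smul {G' : Type u} [Group G'] (φ : G →* G') (g : G) (p : RealE G) :
    SSet.toTop.map (EG.map φ) (g • p) = φ g • SSet.toTop.map (EG.map φ) p := by
  change SSet.toTop.map (EG.map φ) (SSet.toTop.map (EG.smul g) p) =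
    SSet.toTop.map (EG.smul (φ g)) (SSet.toTop.map (EG.map φ) p)
  have h : EG.smul g ≫ EG.map φ = EG.map φ ≫ EG.smul (φ g) := by
    ext n s
    exact funext fun i => map_mul φ g (s i)
  have h' := congrArg SSet.toTop.map h
  rw [SSet.toTop.map_comp, SSet.toTop.map_comp] at h'
  exact congrArg (fun k => k p) h'

/-- The map `|EG|/H → |EG'|/H'` induced by a homomorphism of pairs of groups. -/
noncomputable def RealEmod.map {G' : Type u} [Group G'] {H : Subgroup G} {H' : Subgroup G'}
    (φ : G →* G') (hφ : ∀ a ∈ H, φ a ∈ H') : C(RealEmod H, RealEmod H') where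
  toFun := Quotient.map' (fun p => SSet.toTop.map (EG.map φ) p) (by
    rintro _ p ⟨h, rfl⟩
    exact ⟨⟨φ h, hφ h h.2⟩, (RealE.map_smul φ h p).symm⟩)
  continuous_toFun :=
    Continuous.quotient_map' (SSet.toTop.map (EG.map φ)).hom.continuous _

lemma SSet.map_point {X Y : SSet.{u}} (f : X ⟶ Y) {n : ℕ} (s : X _⦋n⦌)
    (t : _root_.stdSimplex ℝ (Fin (n + 1))) :
    SSet.toTop.map f (SSet.point s t) = SSet.point (f.app _ s) t := by
  have h := congrArg (fun k => k.app (Opposite.op ⦋n⦌) s) (sSetTopAdj.unit.naturality f)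
  change (sSetTopAdj.unit.app Y).app (Opposite.op ⦋n⦌) (f.app (Opposite.op ⦋n⦌) s) = _ at h
  unfold SSet.point
  rw [h]
  rfl

lemma RealEmod.map_base {G' : Type u} [Group G'] {H : Subgroup G} {H' : Subgroup G'}
    (φ : G →* G') (hφ : ∀ a ∈ H, φ a ∈ H') :
    RealEmod.map φ hφ (RealEmod.base H) = RealEmod.base H' := by
  refine congrArg (Quotient.mk (MulAction.orbitRel H' (RealE G'))) ?_
  refine (SSet.map_point (EG.map φ) (EG.base G) (_root_.stdSimplex.vertex 0)).trans ?_
  refine congrArg (fun s => SSet.point (X := EG G') (n := 0) s (_root_.stdSimplex.vertex 0)) ?_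
  exact funext fun _ => map_one φ

/-- The fundamental group `π₁(|EG|/H)`, with the product `[f][g] = [f · g]` given by the path `f`
followed by the path `g`. (The product of `FundamentalGroup` is in the opposite order.) -/
abbrev RealPi1 (H : Subgroup G) : Type u := (FundamentalGroup (RealEmod H) (RealEmod.base H))ᵐᵒᵖ

/-- A path in `|EG|` from `e` to `a e`, with `a ∈ H`, projects to a loop in `|EG|/H`; this is its
class in `π₁(|EG|/H)`. -/
noncomputable def RealPi1.ofLift {H : Subgroup G} (a : H)
    (f : Path (RealE.base G) ((a : G) • RealE.base G)) : RealPi1 H :=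
  MulOpposite.op <| FundamentalGroup.fromPath <| Path.Homotopic.Quotient.mk <|
    (f.map (RealEmod.proj H).continuous).cast rfl (RealEmod.proj_smul_base H a)

end Realization

section FundamentalGroupOperads

/-- The map `π₁(EG/H) → π₁(EG'/H')` induced by a homomorphism of pairs of groups. -/
def SimplicialPi1.map {G G' : Type u} [Group G] [Group G'] {H : Subgroup G} {H' : Subgroup G'}
    (φ : G →* G') (hφ : ∀ a ∈ H, φ a ∈ H') : SimplicialPi1 H → SimplicialPi1 H' :=
  SSet.LoopClasses.map (EGmod.map φ hφ) (EGmod.map_base φ hφ)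

/-- The map `π₁(|EG|/H) → π₁(|EG'|/H')` induced by a homomorphism of pairs of groups. -/
noncomputable def RealPi1.map {G G' : Type u} [Group G] [Group G'] {H : Subgroup G}
    {H' : Subgroup G'} (φ : G →* G') (hφ : ∀ a ∈ H, φ a ∈ H') : RealPi1 H →* RealPi1 H' :=
  MonoidHom.op (FundamentalGroup.mapOfEq (RealEmod.map φ hφ) (RealEmod.map_base φ hφ))

variable {G : ℕ → Type u} [∀ n, Group (G n)]

/-- The composition of the simplicial operad `E𝒢`:
`γ((c₀, …, c_l); (a₁₀, …, a₁ₗ), …) = (γ(c₀; a₁₀, …, a_k₀), …, γ(c_l; a₁ₗ, …, a_kl))`. -/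
def GroupOperad.simplexγ (𝒢 : GroupOperad G) {k : ℕ} (m : Fin k → ℕ) {N : ℕ}
    (h : ∑ i, m i = N) {l : ℕ} (c : (EG (G k)) _⦋l⦌) (a : ∀ i, (EG (G (m i))) _⦋l⦌) :
    (EG (G N)) _⦋l⦌ :=
  fun j : Fin (l + 1) => 𝒢.γ m h (c j) (fun i => a i j)

/-- The graph of the composition of the topological operad `|E𝒢|`: the map
`|EG_k| × |EG_{m₁}| × ⋯ × |EG_{m_k}| → |EG_N|`, the realization of the composition of `E𝒢`,
is given by `([c; t], [a₁; t], …, [a_k; t]) ↦ [γ(c; a₁, …, a_k); t]` (every point of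
the product is of the form `([c; t], [a₁; t], …, [a_k; t])` for simplices `c, a₁, …, a_k` of the same
dimension and one point `t` of the topological simplex). -/
def GroupOperad.IsRealγ (𝒢 : GroupOperad G) {k : ℕ} (m : Fin k → ℕ) {N : ℕ}
    (h : ∑ i, m i = N) (p : RealE (G k)) (q : ∀ i, RealE (G (m i))) (r : RealE (G N)) : Prop :=
  ∃ (l : ℕ) (t : _root_.stdSimplex ℝ (Fin (l + 1))) (c : (EG (G k)) _⦋l⦌)
    (a : ∀ i, (EG (G (m i))) _⦋l⦌),
    p = SSet.point c t ∧ (∀ i, q i = SSet.point (a i) t) ∧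
      r = SSet.point (𝒢.simplexγ m h c a) t

/-- `P` is the operad structure of the fundamental groups operad `π₁(E𝒢/𝓗)`: lift the spherical
`1`-simplices of `EG_n/H_n` to `1`-simplices of `EG_n` starting at `e_n` and ending at `a e_n` with
`a ∈ H_n`. Then `π` is `π(a)`, and `γ` is the class of the composite `γ` of the lifts. -/
structure IsSimplicialPi1Operad {𝒢 : GroupOperad G} (𝓗 : SubGroupOperad 𝒢)
    (P : GroupOperad (fun n => SimplicialPi1 (𝓗.H n))) : Prop where
  π_ofLift : ∀ (n : ℕ) (a : 𝓗.H n)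
    (f : (EG (G n)).Edge (EG.base (G n)) ((EG.smul (a : G n)).app _ (EG.base (G n)))),
    P.π n (SimplicialPi1.ofLift a f) = 𝒢.π n a
  γ_ofLift : ∀ {k : ℕ} (m : Fin k → ℕ) {N : ℕ} (h : ∑ i, m i = N)
    (a : 𝓗.H k) (b : ∀ i, 𝓗.H (m i))
    (f : (EG (G k)).Edge (EG.base (G k)) ((EG.smul (a : G k)).app _ (EG.base (G k))))
    (g : ∀ i, (EG (G (m i))).Edge (EG.base (G (m i)))
      ((EG.smul (b i : G (m i))).app _ (EG.base (G (m i))))),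
    ∃ w : (EG (G N)).Edge (EG.base (G N))
        ((EG.smul (𝓗.toGroupOperad.γ m h a b : G N)).app _ (EG.base (G N))),
      w.edge = 𝒢.simplexγ m h f.edge (fun i => (g i).edge) ∧
      P.γ m h (SimplicialPi1.ofLift a f) (fun i => SimplicialPi1.ofLift (b i) (g i)) =
        SimplicialPi1.ofLift (𝓗.toGroupOperad.γ m h a b) w

/-- `Q` is the operad structure of the fundamental groups operad `π₁(|E𝒢|/𝓗)`: lift the loops of
`|EG_n|/H_n` to paths in `|EG_n|` from `e_n` to `a e_n` with `a ∈ H_n`. Then `π` is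
`π(a)`, and `γ` is the class of the composite path `s ↦ γ(f(s); g₁(s), …, g_k(s))` of the lifts,
which is a path from `e_N = γ(e_k; e_{m₁}, …, e_{m_k})` to `γ(a; b₁, …, b_k) e_N`. -/
structure IsRealPi1Operad {𝒢 : GroupOperad G} (𝓗 : SubGroupOperad 𝒢)
    (Q : GroupOperad (fun n => RealPi1 (𝓗.H n))) : Prop where
  π_ofLift : ∀ (n : ℕ) (a : 𝓗.H n)
    (f : Path (RealE.base (G n)) ((a : G n) • RealE.base (G n))),
    Q.π n (RealPi1.ofLift a f) = 𝒢.π n a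
  γ_ofLift : ∀ {k : ℕ} (m : Fin k → ℕ) {N : ℕ} (h : ∑ i, m i = N)
    (a : 𝓗.H k) (b : ∀ i, 𝓗.H (m i))
    (f : Path (RealE.base (G k)) ((a : G k) • RealE.base (G k)))
    (g : ∀ i, Path (RealE.base (G (m i))) ((b i : G (m i)) • RealE.base (G (m i)))),
    ∃ w : Path (RealE.base (G N)) ((𝓗.toGroupOperad.γ m h a b : G N) • RealE.base (G N)),
      (∀ s : I, 𝒢.IsRealγ m h (f s) (fun i => g i s) (w s)) ∧
      Q.γ m h (RealPi1.ofLift a f) (fun i => RealPi1.ofLift (b i) (g i)) =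
        RealPi1.ofLift (𝓗.toGroupOperad.γ m h a b) w

end FundamentalGroupOperads

end Homotopy

/-! The group `H` is identified with both fundamental groups, and the operad structure is carried
along. Simplicially, a spherical edge `H(a, b)` of `EG/H` is determined by `a⁻¹ b ∈ H`, and
2-simplices multiply these invariants. Topologically, `|EG|` is contractible and `H` acts on it
properly discontinuously, so `|EG| → |EG|/H` is a universal covering with group `H`. In both cases
the class of a lift from `e` to `a e` depends on `a` alone (`SimplicialPi1.ofLift_eq`,
`RealPi1.ofLift_eq`), and every `a ∈ H` has a lift. The prescriptions for `π` and `γ` therefore hold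
for the structure transported from `𝓗` and for no other. Naturality holds because a morphism of
pairs sends a lift ending at `a e` to one ending at `φ(a) e`.

What remains is that composite paths exist and are continuous (`GroupOperad.exists_path_isRealγ`). A
point of `|EG|` is viewed as a step function on `(0, 1]` with values in `G`, the barycentric
coordinates being the lengths of the steps. Two step functions pair to one with values in `A × B`,
on the common refinement of the two partitions (`overlap`). Only paths need to be paired: mapping
into spaces of functions on simplices and on the interval, which are locally compact, replaces any
comparison of `|EA| × |EB|` with `|E(A × B)|`. Applying `γ` to the values of the paired path gives
the composite.

The same picture shows proper discontinuity: the measure of the set where a step function takes a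
given value is continuous (`exists_mass`). -/

section

open CategoryTheory Simplicial Opposite
open scoped unitInterval Topology

/-! ### Universal property and points of the geometric realization -/

namespace SSet

variable {X : SSet.{u}}

lemma continuous_point {n : ℕ} (s : X _⦋n⦌) : Continuous (SSet.point s) :=
  ContinuousMap.continuous _

lemma point_map {n m : ℕ} (θ : ⦋n⦌ ⟶ ⦋m⦌) (s : X _⦋m⦌)
    (t : _root_.stdSimplex ℝ (Fin (n + 1))) :
    point (X.map θ.op s) t = point s (_root_.stdSimplex.map θ t) := by
  have h := congrArg (fun k => k s) ((sSetTopAdj.unit.app X).naturality θ.op)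
  change (sSetTopAdj.unit.app X).app (op ⦋n⦌) (X.map θ.op s) = _ at h
  unfold point
  rw [h]
  rfl

/-- The universal property of the geometric realization: a compatible family of continuous maps on
the simplices induces a continuous map on the realization. -/
lemma exists_continuousMap {Y : Type u} [TopologicalSpace Y]
    (F : ∀ n, X _⦋n⦌ → C(_root_.stdSimplex ℝ (Fin (n + 1)), Y))
    (hF : ∀ {n m : ℕ} (θ : ⦋n⦌ ⟶ ⦋m⦌) (s : X _⦋m⦌) (t : _root_.stdSimplex ℝ (Fin (n + 1))),
      F n (X.map θ.op s) t = F m s (_root_.stdSimplex.map θ t)) :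
    ∃ f : C(SSet.toTop.obj X, Y), ∀ n (s : X _⦋n⦌) t, f (point s t) = F n s t := by
  let φ : X ⟶ TopCat.toSSet.obj (TopCat.of Y) :=
    { app n := ↾fun s => (TopCat.toSSetObjEquiv (TopCat.of Y) n).symm (F n.unop.len s)
      naturality n m θ := by
        ext s
        refine (TopCat.toSSetObjEquiv (TopCat.of Y) m).injective ?_
        ext t
        exact hF θ.unop s t }
  let f : SSet.toTop.obj X ⟶ TopCat.of Y := (sSetTopAdj.homEquiv X (TopCat.of Y)).symm φ
  refine ⟨f.hom, fun n s t => ?_⟩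
  have h : sSetTopAdj.unit.app X ≫ TopCat.toSSet.map f = φ :=
    (Adjunction.homEquiv_unit ..).symm.trans (Equiv.apply_symm_apply _ _)
  have h' := congrArg (fun k => TopCat.toSSetObjEquiv (TopCat.of Y) (op ⦋n⦌)
    (k.app (op ⦋n⦌) s) t) h
  exact h'

lemma hom_ext_point {Y : TopCat.{u}} {f g : SSet.toTop.obj X ⟶ Y}
    (h : ∀ n (s : X _⦋n⦌) t, f (point s t) = g (point s t)) : f = g := by
  refine (sSetTopAdj.homEquiv X Y).injective ?_
  rw [Adjunction.homEquiv_unit, Adjunction.homEquiv_unit]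
  ext n s
  refine (TopCat.toSSetObjEquiv Y n).injective ?_
  ext t
  exact h n.unop.len s t

/-- Every point of the realization lies on a simplex. -/
lemma exists_point (p : SSet.toTop.obj X) :
    ∃ (n : ℕ) (s : X _⦋n⦌) (t : _root_.stdSimplex ℝ (Fin (n + 1))), p = point s t := by
  -- In the indiscrete topology `⊤` every map to `Prop` is continuous. Being of the form `point s t`
  -- is then a continuous map that agrees with the constant `True` on all such points, hence
  -- everywhere by `hom_ext_point`.
  let Y : TopCat.{u} := @TopCat.of (ULift.{u} Prop) ⊤
  let f : SSet.toTop.obj X ⟶ Y := @TopCat.ofHom _ _ _ ⊤ (@ContinuousMap.mk _ _ _ ⊤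
    (fun p => ULift.up (∃ (n : ℕ) (s : X _⦋n⦌) (t : _root_.stdSimplex ℝ (Fin (n + 1))),
      p = point s t)) continuous_top)
  let g : SSet.toTop.obj X ⟶ Y := @TopCat.ofHom _ _ _ ⊤ (@ContinuousMap.mk _ _ _ ⊤
    (fun p => ULift.up True) continuous_top)
  have h : f = g := hom_ext_point fun n s t =>
    congrArg ULift.up (eq_true ⟨n, s, t, rfl⟩)
  have h' : f p = g p := by rw [h]
  exact of_eq_true (congrArg ULift.down h')

end SSet

/-! ### Points of a simplex as partitions of the unit interval, and their common refinement -/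

namespace stdSimplex

variable {ι κ : Type*} [Fintype ι] [Fintype κ]

lemma map_apply [DecidableEq κ] (f : ι → κ) (t : stdSimplex ℝ ι) (k : κ) :
    map f t k = ∑ i with f i = k, t i := by
  rw [map_coe, FunOnFinite.linearMap_apply_apply]

lemma continuous_apply (i : ι) : Continuous fun t : stdSimplex ℝ ι => t i :=
  (_root_.continuous_apply i).comp continuous_subtype_val

section Cumulative

variable [LinearOrder ι] [LinearOrder κ]

/-- The total weight below `i`. -/
def cumLT (t : stdSimplex ℝ ι) (i : ι) : ℝ := ∑ j with j < i, t j

/-- The total weight up to `i`. -/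
def cumLE (t : stdSimplex ℝ ι) (i : ι) : ℝ := ∑ j with j ≤ i, t j

lemma cumLE_eq (t : stdSimplex ℝ ι) (i : ι) : cumLE t i = t i + cumLT t i := by
  have : ({j | j ≤ i} : Finset ι) = insert i ({j | j < i} : Finset ι) := by
    ext j; simp [le_iff_eq_or_lt]
  rw [cumLE, this, Finset.sum_insert (by simp), cumLT]

lemma cumLT_le_cumLE (t : stdSimplex ℝ ι) (i : ι) : cumLT t i ≤ cumLE t i := by
  rw [cumLE_eq]; linarith [zero_le t i]

lemma cumLT_nonneg (t : stdSimplex ℝ ι) (i : ι) : 0 ≤ cumLT t i :=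
  Finset.sum_nonneg fun j _ => zero_le t j

lemma cumLE_nonneg (t : stdSimplex ℝ ι) (i : ι) : 0 ≤ cumLE t i :=
  Finset.sum_nonneg fun j _ => zero_le t j

lemma cumLE_le_one (t : stdSimplex ℝ ι) (i : ι) : cumLE t i ≤ 1 :=
  (Finset.sum_le_univ_sum_of_nonneg fun j => zero_le t j).trans_eq (sum_eq_one t)

lemma cumLE_le_cumLT (t : stdSimplex ℝ ι) {i j : ι} (h : i < j) : cumLE t i ≤ cumLT t j :=
  Finset.sum_le_sum_of_subset_of_nonneg
    (fun k hk => by simp at hk ⊢; exact hk.trans_lt h) fun k _ _ => zero_le t k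

omit [LinearOrder ι] in
lemma cumLT_map {f : ι → κ} (t : stdSimplex ℝ ι) (k : κ) :
    cumLT (map f t) k = ∑ i with f i < k, t i := by
  simp_rw [cumLT, map_apply]
  rw [← Finset.sum_fiberwise_of_maps_to (s := {i | f i < k}) (t := {j | j < k}) (g := f)
    (by simp)]
  refine Finset.sum_congr rfl fun j hj => Finset.sum_congr ?_ fun _ _ => rfl
  ext i
  simp at hj ⊢
  rintro rfl
  exact hj

omit [LinearOrder ι] in
lemma cumLE_map {f : ι → κ} (t : stdSimplex ℝ ι) (k : κ) :
    cumLE (map f t) k = ∑ i with f i ≤ k, t i := by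
  simp_rw [cumLE, map_apply]
  rw [← Finset.sum_fiberwise_of_maps_to (s := {i | f i ≤ k}) (t := {j | j ≤ k}) (g := f)
    (by simp)]
  refine Finset.sum_congr rfl fun j hj => Finset.sum_congr ?_ fun _ _ => rfl
  ext i
  simp at hj ⊢
  rintro rfl
  exact hj

/-- The points of a simplex partition the interval `(0, 1]` into consecutive intervals of
lengths `t i`; this is the length of the part of the `i`-th interval that lies in `(0, α]`
(for `0 ≤ α`). -/
def truncMass (t : stdSimplex ℝ ι) (i : ι) (α : ℝ) : ℝ := min (cumLE t i) α - min (cumLT t i) α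

/-- The intervals of an initial segment are adjacent, so the sum telescopes. The term `min 0 α`
vanishes for `0 ≤ α`; keeping it makes a sign hypothesis unnecessary. -/
lemma sum_truncMass_of_isLowerSet (t : stdSimplex ℝ ι) (α : ℝ) (s : Finset ι)
    (hs : IsLowerSet (s : Set ι)) :
    ∑ i ∈ s, truncMass t i α = min (∑ i ∈ s, t i) α - min 0 α := by
  induction s using Finset.induction_on_max with
  | empty => simp
  | insert a s has ih =>
    have ha : a ∉ s := fun h => lt_irrefl _ (has a h)
    have hLT : ({j | j < a} : Finset ι) = s := by
      ext j
      simp only [Finset.mem_filter, Finset.mem_univ, true_and]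
      refine ⟨fun h => ?_, has j⟩
      have := hs h.le (by simp : a ∈ ((insert a s : Finset ι) : Set ι))
      simp only [Finset.coe_insert, Set.mem_insert_iff, Finset.mem_coe] at this
      exact this.resolve_left h.ne
    have hs' : IsLowerSet (s : Set ι) := by
      rw [← hLT]
      intro x y hxy hx
      simp at hx ⊢
      exact hxy.trans_lt hx
    rw [Finset.sum_insert ha, ih hs', Finset.sum_insert ha, truncMass, cumLE_eq, cumLT, hLT]
    ring

lemma sum_truncMass (t : stdSimplex ℝ ι) {α : ℝ} (h₀ : 0 ≤ α) (h₁ : α ≤ 1) :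
    ∑ i, truncMass t i α = α := by
  rw [sum_truncMass_of_isLowerSet t α Finset.univ (by simpa using isLowerSet_univ), sum_eq_one,
    min_eq_right h₁, min_eq_left h₀, sub_zero]

/-- Since `f` is monotone, `{f ≤ k}` and `{f < k}` are initial segments, and the fibre over `k` is
their difference. This naturality lets truncated masses descend to the realization. -/
lemma truncMass_map {f : ι → κ} (hf : Monotone f) (t : stdSimplex ℝ ι) (k : κ) (α : ℝ) :
    truncMass (map f t) k α = ∑ i with f i = k, truncMass t i α := by
  have hLE := sum_truncMass_of_isLowerSet t α ({i | f i ≤ k} : Finset ι) (fun x y h hx => by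
    simp at hx ⊢; exact (hf h).trans hx)
  have hLT := sum_truncMass_of_isLowerSet t α ({i | f i < k} : Finset ι) (fun x y h hx => by
    simp at hx ⊢; exact (hf h).trans_lt hx)
  have h : ({i | f i ≤ k} : Finset ι) =
      ({i | f i = k} : Finset ι) ∪ ({i | f i < k} : Finset ι) := by
    ext i; simp [le_iff_eq_or_lt]
  rw [truncMass, cumLE_map, cumLT_map]
  rw [h, Finset.sum_union (Finset.disjoint_left.2 fun i hi hi' => by
    simp at hi hi'; exact hi'.ne hi), hLT, ← h] at hLE
  linarith

lemma truncMass_mono (t : stdSimplex ℝ ι) (i : ι) : Monotone (truncMass t i) := by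
  intro α β h
  have := cumLT_le_cumLE t i
  unfold truncMass
  rcases le_total (cumLE t i) α with h₁ | h₁ <;> rcases le_total (cumLE t i) β with h₂ | h₂ <;>
    rcases le_total (cumLT t i) α with h₃ | h₃ <;> rcases le_total (cumLT t i) β with h₄ | h₄ <;>
    simp only [min_eq_left, min_eq_right, h₁, h₂, h₃, h₄] <;> linarith

lemma continuous_truncMass (i : ι) {Z : Type*} [TopologicalSpace Z] {t : Z → stdSimplex ℝ ι}
    {α : Z → ℝ} (ht : Continuous t) (hα : Continuous α) :
    Continuous fun z => truncMass (t z) i (α z) := by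
  have hc (j : ι) : Continuous fun z => t z j := (continuous_apply j).comp ht
  unfold truncMass cumLE cumLT
  fun_prop

lemma continuous_cumLT (i : ι) : Continuous fun t : stdSimplex ℝ ι => cumLT t i :=
  continuous_finsetSum _ fun j _ => continuous_apply j

lemma continuous_cumLE (i : ι) : Continuous fun t : stdSimplex ℝ ι => cumLE t i :=
  continuous_finsetSum _ fun j _ => continuous_apply j

/-- The length of the intersection of the `i`-th interval of `t` and the `j`-th interval of `u`. -/
def overlapMass (t : stdSimplex ℝ ι) (u : stdSimplex ℝ κ) (i : ι) (j : κ) : ℝ :=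
  truncMass u j (cumLE t i) - truncMass u j (cumLT t i)

lemma overlapMass_comm (t : stdSimplex ℝ ι) (u : stdSimplex ℝ κ) (i : ι) (j : κ) :
    overlapMass t u i j = overlapMass u t j i := by
  simp only [overlapMass, truncMass, min_comm (cumLE t i), min_comm (cumLT t i)]
  ring

lemma overlapMass_nonneg (t : stdSimplex ℝ ι) (u : stdSimplex ℝ κ) (i : ι) (j : κ) :
    0 ≤ overlapMass t u i j :=
  sub_nonneg.2 (truncMass_mono u j (cumLT_le_cumLE t i))

lemma sum_overlapMass (t : stdSimplex ℝ ι) (u : stdSimplex ℝ κ) (i : ι) :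
    ∑ j, overlapMass t u i j = t i := by
  simp only [overlapMass, Finset.sum_sub_distrib]
  rw [sum_truncMass u (cumLE_nonneg t i) (cumLE_le_one t i), sum_truncMass u (cumLT_nonneg t i)
    ((cumLT_le_cumLE t i).trans (cumLE_le_one t i)), cumLE_eq]
  ring

lemma overlapMass_map_right {ι' : Type*} [Fintype ι'] [LinearOrder ι'] {f : ι → ι'}
    (hf : Monotone f) (u : stdSimplex ℝ κ) (t : stdSimplex ℝ ι) (j : κ) (i : ι') :
    overlapMass u (map f t) j i = ∑ i' with f i' = i, overlapMass u t j i' := by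
  simp only [overlapMass, Finset.sum_sub_distrib, truncMass_map hf]

lemma cumLT_lt_of_overlapMass_ne_zero {t : stdSimplex ℝ ι} {u : stdSimplex ℝ κ} {i : ι} {j : κ}
    (h : overlapMass t u i j ≠ 0) : cumLT u j < cumLE t i := by
  contrapose! h
  have h₁ := cumLT_le_cumLE t i
  have h₂ := cumLT_le_cumLE u j
  rw [overlapMass, truncMass, truncMass, min_eq_right h, min_eq_right (h.trans h₂),
    min_eq_right (h₁.trans h), min_eq_right ((h₁.trans h).trans h₂)]
  ring

/-- Intervals that meet cannot be ordered oppositely in the two partitions. Hence the support of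
`overlap` is a chain in the product order, on which the second projection is monotone although it is
not so on the lexicographic product. -/
lemma le_of_overlapMass_ne_zero {t : stdSimplex ℝ ι} {u : stdSimplex ℝ κ} {i i' : ι} {j j' : κ}
    (h : overlapMass t u i j ≠ 0) (h' : overlapMass t u i' j' ≠ 0) (hi : i < i') : j ≤ j' := by
  by_contra! hj
  rw [overlapMass_comm] at h'
  exact lt_irrefl _ <| calc
    cumLT u j < cumLE t i := cumLT_lt_of_overlapMass_ne_zero h
    _ ≤ cumLT t i' := cumLE_le_cumLT t hi
    _ < cumLE u j' := cumLT_lt_of_overlapMass_ne_zero h'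
    _ ≤ cumLT u j := cumLE_le_cumLT u hj

/-- The common refinement of two partitions of the interval: a point of the simplex on the
lexicographic product. -/
def overlap (t : stdSimplex ℝ ι) (u : stdSimplex ℝ κ) : stdSimplex ℝ (ι ×ₗ κ) :=
  ⟨fun p : ι ×ₗ κ => overlapMass t u (ofLex p).1 (ofLex p).2, fun _ => overlapMass_nonneg _ _ _ _, by
    rw [← Equiv.sum_comp toLex, Fintype.sum_prod_type]
    exact (Finset.sum_congr rfl fun i _ => sum_overlapMass t u i).trans (sum_eq_one t)⟩

lemma overlap_apply (t : stdSimplex ℝ ι) (u : stdSimplex ℝ κ) (p : ι ×ₗ κ) :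
    overlap t u p = overlapMass t u (ofLex p).1 (ofLex p).2 := rfl

lemma continuous_overlap :
    Continuous fun p : stdSimplex ℝ ι × stdSimplex ℝ κ => overlap p.1 p.2 :=
  Continuous.subtype_mk (continuous_pi fun _ =>
    (continuous_truncMass _ continuous_snd ((continuous_cumLE _).comp continuous_fst)).sub
    (continuous_truncMass _ continuous_snd ((continuous_cumLT _).comp continuous_fst))) _

lemma le_and_le_of_overlap_ne_zero {t : stdSimplex ℝ ι} {u : stdSimplex ℝ κ} {p q : ι ×ₗ κ}
    (hp : overlap t u p ≠ 0) (hq : overlap t u q ≠ 0) (h : p ≤ q) :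
    (ofLex p).1 ≤ (ofLex q).1 ∧ (ofLex p).2 ≤ (ofLex q).2 := by
  rw [Prod.Lex.le_iff] at h
  rcases h with h | ⟨h, h'⟩
  · exact ⟨h.le, le_of_overlapMass_ne_zero hp hq h⟩
  · exact ⟨h.le, h'⟩

lemma map_fst_overlap (t : stdSimplex ℝ ι) (u : stdSimplex ℝ κ) :
    map (fun p : ι ×ₗ κ => (ofLex p).1) (overlap t u) = t := by
  refine stdSimplex.ext (funext fun i => ?_)
  rw [map_apply, Finset.sum_filter, ← Equiv.sum_comp toLex, Fintype.sum_prod_type]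
  simp only [ofLex_toLex, overlap_apply]
  rw [Finset.sum_eq_single i (fun j _ hj => by simp [hj]) (by simp)]
  simpa using sum_overlapMass t u i

lemma map_snd_overlap (t : stdSimplex ℝ ι) (u : stdSimplex ℝ κ) :
    map (fun p : ι ×ₗ κ => (ofLex p).2) (overlap t u) = u := by
  refine stdSimplex.ext (funext fun i => ?_)
  rw [map_apply, Finset.sum_filter, ← Equiv.sum_comp toLex, Fintype.sum_prod_type_right]
  simp only [ofLex_toLex, overlap_apply]
  rw [Finset.sum_eq_single i (fun j _ hj => by simp [hj]) (by simp)]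
  simpa [overlapMass_comm t u] using sum_overlapMass u t i

/-- Merging intervals of `t` adds their overlaps with each interval of `u`; with `overlap_map_right`
this makes the pairing compatible with faces and degeneracies. -/
lemma overlap_map_left {ι' : Type*} [Fintype ι'] [LinearOrder ι'] {f : ι → ι'} (hf : Monotone f)
    (t : stdSimplex ℝ ι) (u : stdSimplex ℝ κ) :
    overlap (map f t) u =
      map (fun p : ι ×ₗ κ => toLex (f (ofLex p).1, (ofLex p).2)) (overlap t u) := by
  refine stdSimplex.ext (funext fun p => ?_)
  obtain ⟨⟨i, j⟩, rfl⟩ := toLex.surjective p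
  rw [map_apply, Finset.sum_filter, ← Equiv.sum_comp toLex, Fintype.sum_prod_type_right]
  simp only [ofLex_toLex, overlap_apply, EmbeddingLike.apply_eq_iff_eq, Prod.mk.injEq]
  rw [Finset.sum_eq_single j (fun k _ hk => by simp [hk]) (by simp), overlapMass_comm,
    overlapMass_map_right hf, Finset.sum_filter]
  simp [overlapMass_comm t u]

lemma overlap_map_right {κ' : Type*} [Fintype κ'] [LinearOrder κ'] {f : κ → κ'} (hf : Monotone f)
    (t : stdSimplex ℝ ι) (u : stdSimplex ℝ κ) :
    overlap t (map f u) =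
      map (fun p : ι ×ₗ κ => toLex ((ofLex p).1, f (ofLex p).2)) (overlap t u) := by
  refine stdSimplex.ext (funext fun p => ?_)
  obtain ⟨⟨i, j⟩, rfl⟩ := toLex.surjective p
  rw [map_apply, Finset.sum_filter, ← Equiv.sum_comp toLex, Fintype.sum_prod_type]
  simp only [ofLex_toLex, overlap_apply, EmbeddingLike.apply_eq_iff_eq, Prod.mk.injEq]
  rw [Finset.sum_eq_single i (fun k _ hk => by simp [hk]) (by simp),
    overlapMass_map_right hf, Finset.sum_filter]
  simp

end Cumulative

end stdSimplex

/-! ### Points of `|EG|` indexed by finite linear orders -/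

namespace RealE

variable {G : Type u}

lemma point_comp {n m : ℕ} (f : Fin (n + 1) →o Fin (m + 1)) (x : Fin (m + 1) → G)
    (t : _root_.stdSimplex ℝ (Fin (n + 1))) :
    SSet.point (X := EG G) (n := n) (x ∘ f) t =
      SSet.point (X := EG G) (n := m) x (_root_.stdSimplex.map f t) :=
  SSet.point_map (X := EG G) (SimplexCategory.mkHom f) x t

/-- Vertices of weight zero do not matter: `t` comes from a point `t'` of the face spanned by its
support, and restricted to that face `f` is a genuine simplicial operator. -/
lemma point_comp_of_monotoneOn {n m : ℕ} {f : Fin (n + 1) → Fin (m + 1)}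
    {t : _root_.stdSimplex ℝ (Fin (n + 1))} (hf : MonotoneOn f {i | t i ≠ 0})
    (x : Fin (m + 1) → G) :
    SSet.point (X := EG G) (n := n) (x ∘ f) t =
      SSet.point (X := EG G) (n := m) x (_root_.stdSimplex.map f t) := by
  let S : Finset (Fin (n + 1)) := {i | t i ≠ 0}
  have hsum : ∑ i ∈ S, t i = 1 := by
    rw [Finset.sum_filter_ne_zero, _root_.stdSimplex.sum_eq_one]
  have hS : S.Nonempty := by
    rw [Finset.nonempty_iff_ne_empty]
    rintro h
    simp [h] at hsum
  obtain ⟨l, hl⟩ : ∃ l, S.card = l + 1 := Nat.exists_eq_add_one.2 hS.card_pos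
  let ι := S.orderEmbOfFin hl
  have hι (i) : t (ι i) ≠ 0 := (Finset.mem_filter.1 (S.orderEmbOfFin_mem hl i)).2
  let t' : _root_.stdSimplex ℝ (Fin (l + 1)) := ⟨fun i => t (ι i), fun _ => t.2.1 _, by
    rw [← hsum, ← Finset.image_orderEmbOfFin_univ S hl, Finset.sum_image fun _ _ _ _ h =>
      ι.injective h]⟩
  have ht : _root_.stdSimplex.map ι t' = t := by
    refine _root_.stdSimplex.ext (funext fun i => ?_)
    rw [_root_.stdSimplex.map_apply]
    by_cases hi : t i = 0
    · rw [hi]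
      refine Finset.sum_eq_zero fun j hj => ?_
      rw [Finset.mem_filter] at hj
      exact absurd hi (hj.2 ▸ hι j)
    · obtain ⟨j, rfl⟩ : ∃ j, ι j = i := by
        have : i ∈ Set.range ι := by
          rw [Finset.range_orderEmbOfFin]
          simpa [S] using hi
        exact this
      rw [Finset.sum_eq_single j (fun k hk hkj =>
          absurd (ι.injective (Finset.mem_filter.1 hk).2) hkj)
        (by simp)]
      rfl
  have hmono : Monotone (f ∘ ι) := fun i j hij => hf (hι i) (hι j) (ι.monotone hij)
  calc SSet.point (X := EG G) (n := n) (x ∘ f) t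
      = SSet.point (X := EG G) (n := n) (x ∘ f) (_root_.stdSimplex.map ι t') := by rw [ht]
    _ = SSet.point (X := EG G) (n := l) ((x ∘ f) ∘ ι) t' := (point_comp ι.toOrderHom _ _).symm
    _ = SSet.point (X := EG G) (n := m) x (_root_.stdSimplex.map (f ∘ ι) t') :=
      point_comp ⟨f ∘ ι, hmono⟩ _ _
    _ = _ := by rw [← _root_.stdSimplex.map_comp_apply, ht]

section Weights

variable {ι κ : Type} [Fintype ι] [LinearOrder ι] [Nonempty ι] [Fintype κ] [LinearOrder κ]
  [Nonempty κ]

variable (ι) in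
/-- The order isomorphism from `{0, …, n}` to a finite nonempty linear order. -/
noncomputable def indexIso : Fin (Fintype.card ι - 1 + 1) ≃o ι :=
  (Fin.castOrderIso (Nat.sub_add_cancel Fintype.card_pos)).trans (Fintype.orderIsoFinOfCardEq ι rfl)

/-- The point of `|EG|` with vertices and barycentric coordinates indexed by a finite linear
order. -/
noncomputable def pt (x : ι → G) (w : _root_.stdSimplex ℝ ι) : RealE G :=
  SSet.point (X := EG G) (n := Fintype.card ι - 1) (x ∘ indexIso ι)
    (_root_.stdSimplex.map (indexIso ι).symm w)

lemma continuous_pt (x : ι → G) : Continuous (pt x) :=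
  (SSet.continuous_point _).comp (_root_.stdSimplex.continuous_map _)

lemma pt_fin {n : ℕ} (x : Fin (n + 1) → G) (w : _root_.stdSimplex ℝ (Fin (n + 1))) :
    pt x w = SSet.point (X := EG G) (n := n) x w := by
  refine (point_comp (indexIso (Fin (n + 1))).toOrderEmbedding.toOrderHom x _).trans ?_
  congr 1
  refine (_root_.stdSimplex.map_comp_apply _ _ _).trans ?_
  convert _root_.stdSimplex.map_id_apply w
  ext i
  simp

lemma pt_comp {f : ι → κ} {w : _root_.stdSimplex ℝ ι} (hf : MonotoneOn f {i | w i ≠ 0})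
    (x : κ → G) : pt (x ∘ f) w = pt x (_root_.stdSimplex.map f w) := by
  have h := point_comp_of_monotoneOn (f := (indexIso κ).symm ∘ f ∘ indexIso ι)
    (t := _root_.stdSimplex.map (indexIso ι).symm w) ?_ (x ∘ indexIso κ)
  · rw [_root_.stdSimplex.map_comp_apply] at h
    unfold pt
    rw [_root_.stdSimplex.map_comp_apply]
    have h₁ : (x ∘ indexIso κ) ∘ (indexIso κ).symm ∘ f ∘ indexIso ι = (x ∘ f) ∘ indexIso ι := by
      ext i
      simp
    have h₂ : ((indexIso κ).symm ∘ f ∘ indexIso ι) ∘ (indexIso ι).symm = (indexIso κ).symm ∘ f := by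
      ext i
      simp
    rw [h₁, h₂] at h
    exact h
  · intro i hi j hj hij
    have key (k) : _root_.stdSimplex.map (indexIso ι).symm w k = w (indexIso ι k) := by
      rw [_root_.stdSimplex.map_apply, Finset.sum_eq_single (indexIso ι k)]
      · intro b hb hbk
        rw [Finset.mem_filter] at hb
        exact absurd (by rw [← hb.2]; simp) hbk
      · simp
    refine (indexIso κ).symm.monotone (hf ?_ ?_ ((indexIso ι).monotone hij))
    · rw [Set.mem_ofPred_eq, ← key]; exact hi
    · rw [Set.mem_ofPred_eq, ← key]; exact hj

end Weights

/-- The map `|EG| → |EG'|` induced by a map of sets `G → G'`. -/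
noncomputable def mapFun {G' : Type u} (φ : G → G') : C(RealE G, RealE G') :=
  (SSet.toTop.map (show EG G ⟶ EG G' from
    { app n := ↾fun (s : Fin (n.unop.len + 1) → G) => fun i => φ (s i)
      naturality _ _ _ := rfl })).hom

lemma mapFun_point {G' : Type u} (φ : G → G') {n : ℕ} (x : Fin (n + 1) → G) (t) :
    mapFun φ (SSet.point (X := EG G) (n := n) x t) =
      SSet.point (X := EG G') (n := n) (φ ∘ x) t :=
  SSet.map_point _ _ _

lemma mapFun_pt {G' : Type u} (φ : G → G') {ι : Type} [Fintype ι] [LinearOrder ι]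
    [Nonempty ι] (x : ι → G) (w : _root_.stdSimplex ℝ ι) :
    mapFun φ (pt x w) = pt (φ ∘ x) w :=
  mapFun_point _ _ _

lemma smul_point [Group G] (g : G) {n : ℕ} (x : Fin (n + 1) → G) (t) :
    g • SSet.point (X := EG G) (n := n) x t =
      SSet.point (X := EG G) (n := n) (fun i => g * x i) t :=
  SSet.map_point _ _ _

/-- The vertex `g` of `|EG|`. -/
noncomputable def vertex (g : G) : RealE G :=
  SSet.point (X := EG G) (n := 0) (fun _ : Fin 1 => g) (_root_.stdSimplex.vertex 0)

lemma smul_base [Group G] (g : G) : g • RealE.base G = vertex g := by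
  refine (smul_point g _ _).trans ?_
  exact congrArg (fun s => SSet.point (X := EG G) (n := 0) s (_root_.stdSimplex.vertex 0))
    (funext fun _ => mul_one g)

/-- A constant simplex is degenerate, so it collapses to its vertex. This identifies the end points
of paired paths. -/
lemma pt_const {ι : Type} [Fintype ι] [LinearOrder ι] [Nonempty ι] (g : G)
    (w : _root_.stdSimplex ℝ ι) : pt (fun _ => g) w = vertex g := by
  refine (pt_comp (f := fun _ => (0 : Fin 1)) (fun _ _ _ _ _ => le_rfl) (fun _ => g)).trans ?_
  rw [pt_fin (n := 0), vertex]
  congr 1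
  exact Subsingleton.elim (α := _root_.stdSimplex ℝ (Fin 1)) _ _

end RealE

/-! ### Pairing of paths and composition in `|E𝒢|` -/

namespace RealE

variable {A B C : Type u}

lemma mapFun_vertex (φ : A → B) (a : A) : mapFun φ (vertex a) = vertex (φ a) :=
  mapFun_point _ _ _

lemma mapFun_mapFun (ψ : B → C) (φ : A → B) (p : RealE A) :
    mapFun ψ (mapFun φ p) = mapFun (ψ ∘ φ) p := by
  obtain ⟨n, x, t, rfl⟩ := SSet.exists_point (X := EG A) p
  exact ((congrArg _ (mapFun_point φ x t)).trans (mapFun_point ψ (φ ∘ x) t)).trans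
    (mapFun_point (ψ ∘ φ) x t).symm

/-- The point of `|E(A × B)|` determined by points of a simplex of `|EA|` and of a simplex of
`|EB|`. -/
noncomputable def pairPt {p q : ℕ} (a : Fin (p + 1) → A) (b : Fin (q + 1) → B)
    (t : _root_.stdSimplex ℝ (Fin (p + 1))) (u : _root_.stdSimplex ℝ (Fin (q + 1))) :
    RealE (A × B) :=
  pt (ι := Fin (p + 1) ×ₗ Fin (q + 1)) (fun r => (a (ofLex r).1, b (ofLex r).2))
    (_root_.stdSimplex.overlap t u)

lemma continuous_pairPt {p q : ℕ} (a : Fin (p + 1) → A) (b : Fin (q + 1) → B) :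
    Continuous fun r : _root_.stdSimplex ℝ (Fin (p + 1)) × _root_.stdSimplex ℝ (Fin (q + 1)) =>
      pairPt a b r.1 r.2 :=
  (continuous_pt _).comp _root_.stdSimplex.continuous_overlap

/-- If `θ` identifies two indices, reindexing the first coordinate may break the lexicographic
order. It is monotone on the support of the overlap, which is all that `pt_comp` requires. -/
lemma pairPt_map_left {p p' q : ℕ} (θ : Fin (p' + 1) →o Fin (p + 1)) (a : Fin (p + 1) → A)
    (b : Fin (q + 1) → B) (t : _root_.stdSimplex ℝ (Fin (p' + 1)))
    (u : _root_.stdSimplex ℝ (Fin (q + 1))) :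
    pairPt (a ∘ θ) b t u = pairPt a b (_root_.stdSimplex.map θ t) u := by
  unfold pairPt
  rw [_root_.stdSimplex.overlap_map_left θ.monotone, ← pt_comp]
  · rfl
  · intro r hr r' hr' h
    have := _root_.stdSimplex.le_and_le_of_overlap_ne_zero hr hr' h
    exact Prod.Lex.toLex_mono ⟨θ.monotone this.1, this.2⟩

lemma pairPt_map_right {p q q' : ℕ} (θ : Fin (q' + 1) →o Fin (q + 1)) (a : Fin (p + 1) → A)
    (b : Fin (q + 1) → B) (t : _root_.stdSimplex ℝ (Fin (p + 1)))
    (u : _root_.stdSimplex ℝ (Fin (q' + 1))) :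
    pairPt a (b ∘ θ) t u = pairPt a b t (_root_.stdSimplex.map θ u) := by
  unfold pairPt
  rw [_root_.stdSimplex.overlap_map_right θ.monotone, ← pt_comp]
  · rfl
  · intro r hr r' hr' h
    have := _root_.stdSimplex.le_and_le_of_overlap_ne_zero hr hr' h
    exact Prod.Lex.toLex_mono ⟨this.1, θ.monotone this.2⟩

lemma mapFun_fst_pairPt {p q : ℕ} (a : Fin (p + 1) → A) (b : Fin (q + 1) → B)
    (t : _root_.stdSimplex ℝ (Fin (p + 1))) (u : _root_.stdSimplex ℝ (Fin (q + 1))) :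
    mapFun (Prod.fst : A × B → A) (pairPt a b t u) = SSet.point (X := EG A) (n := p) a t := by
  have h : pt (G := A) a (_root_.stdSimplex.map (fun r : Fin (p + 1) ×ₗ Fin (q + 1) => (ofLex r).1)
      (_root_.stdSimplex.overlap t u)) = SSet.point (X := EG A) (n := p) a t := by
    rw [_root_.stdSimplex.map_fst_overlap, pt_fin]
  rw [← h, ← pt_comp (fun r hr r' hr' h =>
    (_root_.stdSimplex.le_and_le_of_overlap_ne_zero hr hr' h).1)]
  exact mapFun_pt (G := A × B) (G' := A) Prod.fst _ _

lemma mapFun_snd_pairPt {p q : ℕ} (a : Fin (p + 1) → A) (b : Fin (q + 1) → B)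
    (t : _root_.stdSimplex ℝ (Fin (p + 1))) (u : _root_.stdSimplex ℝ (Fin (q + 1))) :
    mapFun (Prod.snd : A × B → B) (pairPt a b t u) = SSet.point (X := EG B) (n := q) b u := by
  have h : pt (G := B) b (_root_.stdSimplex.map (fun r : Fin (p + 1) ×ₗ Fin (q + 1) => (ofLex r).2)
      (_root_.stdSimplex.overlap t u)) = SSet.point (X := EG B) (n := q) b u := by
    rw [_root_.stdSimplex.map_snd_overlap, pt_fin]
  rw [← h, ← pt_comp (fun r hr r' hr' h =>
    (_root_.stdSimplex.le_and_le_of_overlap_ne_zero hr hr' h).2)]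
  exact mapFun_pt (G := A × B) (G' := B) Prod.snd _ _

/-- The pairing with a fixed simplex of `EB`. -/
lemma exists_pairing_simplex {q : ℕ} (b : Fin (q + 1) → B) :
    ∃ M : C(RealE A, C(_root_.stdSimplex ℝ (Fin (q + 1)), RealE (A × B))),
      ∀ (p : ℕ) (a : Fin (p + 1) → A) t u,
        M (SSet.point (X := EG A) (n := p) a t) u = pairPt a b t u := by
  obtain ⟨M, hM⟩ := SSet.exists_continuousMap (X := EG A)
    (Y := C(_root_.stdSimplex ℝ (Fin (q + 1)), RealE (A × B)))
    (fun p a => ContinuousMap.curry ⟨fun r => pairPt (p := p) a b r.1 r.2, continuous_pairPt _ _⟩)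
    (fun θ a t => ContinuousMap.ext fun u => pairPt_map_left θ.toOrderHom a b t u)
  exact ⟨M, fun p a t u => congrArg (fun k => k u) (hM p a t)⟩

/-- Two paths in `|EA|` and `|EB|` combine to a path in `|E(A × B)|`. -/
lemma exists_pairing (f : C(I, RealE A)) (g : C(I, RealE B)) :
    ∃ F : C(I, RealE (A × B)), (∀ s, mapFun Prod.fst (F s) = f s) ∧
      (∀ s, mapFun Prod.snd (F s) = g s) ∧
      ∀ s x y, f s = vertex x → g s = vertex y → F s = vertex (x, y) := by
  choose M hM using fun (q : ℕ) (b : Fin (q + 1) → B) => exists_pairing_simplex (A := A) b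
  -- For fixed `b`, the map `(u, s) ↦ M q b (f s) u` is jointly continuous because evaluation on
  -- functions on the locally compact simplex is. The path is `s ↦ N (g s) s`, continuous since `I`
  -- is locally compact.
  obtain ⟨N, hN⟩ := SSet.exists_continuousMap (X := EG B) (Y := C(I, RealE (A × B)))
    (fun q b => ContinuousMap.curry
      ⟨fun r : _root_.stdSimplex ℝ (Fin (q + 1)) × I => M q b (f r.2) r.1, by fun_prop⟩)
    (fun {q' q} θ b u => ContinuousMap.ext fun s => by
      change M q' (b ∘ θ.toOrderHom) (f s) u = M q b (f s) (_root_.stdSimplex.map θ.toOrderHom u)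
      obtain ⟨p, a, t, h⟩ := SSet.exists_point (X := EG A) (f s)
      rw [h]
      exact (hM q' (b ∘ θ.toOrderHom) p a t u).trans
        ((pairPt_map_right θ.toOrderHom a b t u).trans (hM q b p a t _).symm))
  have key (s : I) {p q : ℕ} (a : Fin (p + 1) → A) (b : Fin (q + 1) → B) (t u)
      (hf : f s = SSet.point (X := EG A) (n := p) a t)
      (hg : g s = SSet.point (X := EG B) (n := q) b u) : N (g s) s = pairPt a b t u := by
    rw [hg, hN q b u]
    change M q b (f s) u = _
    rw [hf, hM]
  refine ⟨⟨fun s => N (g s) s, by fun_prop⟩, fun s => ?_, fun s => ?_, fun s x y hx hy => ?_⟩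
  · obtain ⟨p, a, t, hf⟩ := SSet.exists_point (X := EG A) (f s)
    obtain ⟨q, b, u, hg⟩ := SSet.exists_point (X := EG B) (g s)
    exact (congrArg _ (key s a b t u hf hg)).trans ((mapFun_fst_pairPt a b t u).trans hf.symm)
  · obtain ⟨p, a, t, hf⟩ := SSet.exists_point (X := EG A) (f s)
    obtain ⟨q, b, u, hg⟩ := SSet.exists_point (X := EG B) (g s)
    exact (congrArg _ (key s a b t u hf hg)).trans ((mapFun_snd_pairPt a b t u).trans hg.symm)
  · exact (key s _ _ _ _ hx hy).trans (pt_const (x, y) _)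

/-- Finitely many paths in the spaces `|EA_i|` combine to a path in `|E(∏ A_i)|`. -/
lemma exists_pi_pairing {k : ℕ} {A : Fin k → Type u} (f : ∀ i, C(I, RealE (A i))) :
    ∃ F : C(I, RealE (∀ i, A i)), (∀ i s, mapFun (fun x => x i) (F s) = f i s) ∧
      ∀ s x, (∀ i, f i s = vertex (x i)) → F s = vertex x := by
  induction k with
  | zero =>
    exact ⟨.const I (vertex fun i => i.elim0), fun i => i.elim0, fun s x _ =>
      congrArg vertex (Subsingleton.elim _ _)⟩
  | succ k ih =>
    obtain ⟨F, hF, hF'⟩ := ih fun i => f i.succ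
    obtain ⟨K, h₁, h₂, h₃⟩ := exists_pairing (f 0) F
    refine ⟨(mapFun fun x => Fin.cons x.1 x.2).comp K, fun i s => ?_, fun s x hx => ?_⟩
    · refine (mapFun_mapFun _ _ _).trans ?_
      refine Fin.cases ?_ (fun j => ?_) i
      · exact h₁ s
      · rw [← hF j s, ← h₂ s]
        exact (mapFun_mapFun (fun x : ∀ i : Fin k, A i.succ => x j) Prod.snd (K s)).symm
    · refine (congrArg _ (h₃ s (x 0) (fun i => x i.succ) (hx 0)
        (hF' s _ fun i => hx i.succ))).trans ?_
      exact (mapFun_vertex _ _).trans (congrArg vertex (Fin.cons_self_tail x))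

end RealE

/-- The composite of paths in the topological operad `|E𝒢|`. -/
lemma GroupOperad.exists_path_isRealγ {G : ℕ → Type u} [∀ n, Group (G n)] (𝒢 : GroupOperad G)
    {k : ℕ} (m : Fin k → ℕ) {N : ℕ} (h : ∑ i, m i = N) {a a' : G k} {b b' : ∀ i, G (m i)}
    (f : Path (RealE.vertex a) (RealE.vertex a'))
    (g : ∀ i, Path (RealE.vertex (b i)) (RealE.vertex (b' i))) :
    ∃ w : Path (RealE.vertex (𝒢.γ m h a b)) (RealE.vertex (𝒢.γ m h a' b')),
      ∀ s, 𝒢.IsRealγ m h (f s) (fun i => g i s) (w s) := by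
  obtain ⟨F, hF, hF'⟩ := RealE.exists_pi_pairing fun i => (g i).toContinuousMap
  obtain ⟨K, h₁, h₂, h₃⟩ := RealE.exists_pairing f.toContinuousMap F
  -- `φ` is not a homomorphism, but `mapFun` needs only a map of sets.
  let φ : G k × (∀ i, G (m i)) → G N := fun x => 𝒢.γ m h x.1 x.2
  refine ⟨⟨(RealE.mapFun φ).comp K, ?_, ?_⟩, fun s => ?_⟩
  · exact (congrArg _ (h₃ 0 a b f.source (hF' 0 b fun i => (g i).source))).trans
      (RealE.mapFun_vertex _ _)
  · exact (congrArg _ (h₃ 1 a' b' f.target (hF' 1 b' fun i => (g i).target))).trans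
      (RealE.mapFun_vertex _ _)
  -- A simplex of the paired path is a tuple of simplices of one dimension with one common `t`, as
  -- the graph of `γ` demands.
  · obtain ⟨l, x, t, hx⟩ := SSet.exists_point (X := EG _) (K s)
    refine ⟨l, t, fun j : Fin (l + 1) => ((show Fin (l + 1) → _ from x) j).1,
      fun i (j : Fin (l + 1)) => ((show Fin (l + 1) → _ from x) j).2 i, ?_, fun i => ?_, ?_⟩
    · refine (h₁ s).symm.trans ?_
      rw [hx]
      exact RealE.mapFun_point _ _ _
    · refine (hF i s).symm.trans ?_
      rw [← h₂ s, RealE.mapFun_mapFun, hx]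
      exact RealE.mapFun_point _ _ _
    · refine (congrArg (RealE.mapFun φ) hx).trans ?_
      exact RealE.mapFun_point _ _ _

/-! ### Contractibility of `|EG|` by coning -/

namespace stdSimplex

/-- The point dividing the segment from the new vertex `0` to the point `t` of the opposite face in
the ratio `1 - s : s`. -/
noncomputable def cone {n : ℕ} (s : I) (t : stdSimplex ℝ (Fin (n + 1))) :
    stdSimplex ℝ (Fin (n + 2)) :=
  ⟨Fin.cons (s : ℝ) fun i => (1 - s) * t i, fun i => by
    refine Fin.cases s.2.1 (fun j => ?_) i
    exact mul_nonneg (sub_nonneg.2 s.2.2) (zero_le t j), by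
    rw [Fin.sum_univ_succ]
    simp only [Fin.cons_zero, Fin.cons_succ, ← Finset.mul_sum, sum_eq_one]
    ring⟩

@[simp]
lemma cone_zero {n : ℕ} (s : I) (t : stdSimplex ℝ (Fin (n + 1))) : cone s t 0 = s := rfl

@[simp]
lemma cone_succ {n : ℕ} (s : I) (t : stdSimplex ℝ (Fin (n + 1))) (i : Fin (n + 1)) :
    cone s t i.succ = (1 - s) * t i := rfl

lemma continuous_cone {n : ℕ} :
    Continuous fun p : stdSimplex ℝ (Fin (n + 1)) × I => cone p.2 p.1 := by
  refine Continuous.subtype_mk (continuous_pi fun i => ?_) _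
  refine Fin.cases ?_ (fun j => ?_) i
  · exact continuous_subtype_val.comp continuous_snd
  · exact (continuous_const.sub (continuous_subtype_val.comp continuous_snd)).mul
      ((continuous_apply j).comp continuous_fst)

/-- The extension of a monotone map by the new smallest element `0`. -/
def consHom {n m : ℕ} (θ : Fin (n + 1) →o Fin (m + 1)) : Fin (n + 2) →o Fin (m + 2) where
  toFun := Fin.cons 0 fun i => (θ i).succ
  monotone' i j := by
    refine Fin.cases (fun _ => Fin.zero_le _) (fun i => ?_) i
    refine Fin.cases (fun h => ?_) (fun j h => ?_) j
    · exact absurd h (by simp)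
    · simpa using θ.monotone (Fin.succ_le_succ_iff.1 h)

lemma consHom_zero {n m : ℕ} (θ : Fin (n + 1) →o Fin (m + 1)) : consHom θ 0 = 0 := rfl

lemma consHom_succ {n m : ℕ} (θ : Fin (n + 1) →o Fin (m + 1)) (i : Fin (n + 1)) :
    consHom θ i.succ = (θ i).succ := rfl

lemma map_consHom_cone {n m : ℕ} (θ : Fin (n + 1) →o Fin (m + 1)) (s : I)
    (t : stdSimplex ℝ (Fin (n + 1))) : map (consHom θ) (cone s t) = cone s (map θ t) := by
  refine stdSimplex.ext (funext fun i => ?_)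
  rw [map_apply, Finset.sum_filter, Fin.sum_univ_succ]
  refine Fin.cases ?_ (fun j => ?_) i
  · simp [consHom_zero, consHom_succ]
  · simp [consHom_zero, consHom_succ, map_apply, Finset.sum_filter, Finset.mul_sum,
      (Fin.succ_ne_zero j).symm]

lemma cone_at_zero {n : ℕ} (t : stdSimplex ℝ (Fin (n + 1))) : cone 0 t = map Fin.succ t := by
  refine stdSimplex.ext (funext fun i => ?_)
  rw [map_apply, Finset.sum_filter]
  refine Fin.cases ?_ (fun j => ?_) i <;> simp

lemma cone_at_one {n : ℕ} (t : stdSimplex ℝ (Fin (n + 1))) : cone 1 t = vertex 0 := by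
  refine stdSimplex.ext (funext fun i => ?_)
  refine Fin.cases ?_ (fun j => ?_) i <;> simp

end stdSimplex

namespace RealE

variable (G : Type u) [Group G]

omit [Group G] in
lemma point_vertex {n : ℕ} (x : Fin (n + 1) → G) (i : Fin (n + 1)) :
    SSet.point (X := EG G) (n := n) x (_root_.stdSimplex.vertex i) = vertex (x i) := by
  have h := point_comp (G := G) (n := 0) (m := n) ⟨fun _ => i, fun _ _ _ => le_rfl⟩ x
    (_root_.stdSimplex.vertex 0)
  rw [_root_.stdSimplex.map_vertex] at h
  exact h.symm

/-- The cone construction contracts `|EG|` to the vertex `e`. -/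
instance : ContractibleSpace (RealE G) := by
  -- Prepending the vertex `1` to each simplex gives a cone compatible with all simplicial
  -- operators. Taking values in `C(I, RealE G)` yields the whole homotopy from the universal
  -- property.
  obtain ⟨F, hF⟩ := SSet.exists_continuousMap (X := EG G) (Y := C(I, RealE G))
    (fun n x => ContinuousMap.curry ⟨fun r : _root_.stdSimplex ℝ (Fin (n + 1)) × I =>
      SSet.point (X := EG G) (n := n + 1) (Fin.cons (1 : G) (show Fin (n + 1) → G from x))
        (_root_.stdSimplex.cone r.2 r.1),
      (SSet.continuous_point _).comp _root_.stdSimplex.continuous_cone⟩)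
    (fun {n m} θ x t => ContinuousMap.ext fun s => by
      have h := point_comp (_root_.stdSimplex.consHom θ.toOrderHom)
        (Fin.cons (1 : G) (show Fin (m + 1) → G from x)) (_root_.stdSimplex.cone s t)
      rw [_root_.stdSimplex.map_consHom_cone] at h
      refine Eq.trans ?_ h
      refine congrArg (fun y => SSet.point (X := EG G) (n := n + 1) y
        (_root_.stdSimplex.cone s t)) (funext fun i => ?_)
      refine Fin.cases ?_ (fun j => ?_) i <;> rfl)
  refine (contractible_iff_id_nullhomotopic _).2 ⟨vertex 1, ⟨⟨⟨fun r => F r.2 r.1, by fun_prop⟩,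
    fun p => ?_, fun p => ?_⟩⟩⟩
  · obtain ⟨n, x, t, rfl⟩ := SSet.exists_point (X := EG G) p
    refine (congrArg (fun k => k 0) (hF n x t)).trans ?_
    change SSet.point (X := EG G) (n := n + 1) (Fin.cons (1 : G) (show Fin (n + 1) → G from x))
      (_root_.stdSimplex.cone 0 t) = _
    rw [_root_.stdSimplex.cone_at_zero]
    exact (point_comp (Fin.succOrderEmb _).toOrderHom _ _).symm
  · obtain ⟨n, x, t, rfl⟩ := SSet.exists_point (X := EG G) p
    refine (congrArg (fun k => k 1) (hF n x t)).trans ?_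
    change SSet.point (X := EG G) (n := n + 1) (Fin.cons (1 : G) (show Fin (n + 1) → G from x))
      (_root_.stdSimplex.cone 1 t) = _
    rw [_root_.stdSimplex.cone_at_one, point_vertex]
    rfl

/-! ### Proper discontinuity and the covering `|EG| → |EG|/H` -/

variable {G}

omit [Group G] in
open Classical in
/-- Viewing the points of `|EG|` as step functions on `(0, 1]`, the measure of the set of points of
`(α, β]` with value `g` is continuous. -/
lemma exists_mass (α β : ℝ) (g : G) :
    ∃ μ : C(RealE G, ℝ), ∀ n (x : Fin (n + 1) → G) t, μ (SSet.point (X := EG G) (n := n) x t) =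
      ∑ j with x j = g, (_root_.stdSimplex.truncMass t j β - _root_.stdSimplex.truncMass t j α) := by
  -- `ULift` only moves `ℝ` to the universe of the realization.
  obtain ⟨F, hF⟩ := SSet.exists_continuousMap (X := EG G) (Y := ULift.{u} ℝ)
    (fun n x => ⟨fun t => ULift.up (∑ j with (show Fin (n + 1) → G from x) j = g,
      (_root_.stdSimplex.truncMass t j β - _root_.stdSimplex.truncMass t j α)),
      continuous_uliftUp.comp (continuous_finsetSum _ fun j _ =>
        (_root_.stdSimplex.continuous_truncMass j continuous_id continuous_const).sub
        (_root_.stdSimplex.continuous_truncMass j continuous_id continuous_const))⟩)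
    (fun {n m} θ x t => congrArg ULift.up (by
      change ∑ j with (show Fin (m + 1) → G from x) (θ.toOrderHom j) = g, _ =
        ∑ j with _, (_root_.stdSimplex.truncMass (_root_.stdSimplex.map θ.toOrderHom t) j β -
          _root_.stdSimplex.truncMass (_root_.stdSimplex.map θ.toOrderHom t) j α)
      simp only [_root_.stdSimplex.truncMass_map θ.toOrderHom.monotone,
        ← Finset.sum_sub_distrib]
      rw [← Finset.sum_fiberwise_of_maps_to (g := θ.toOrderHom)
        (t := {j | (show Fin (m + 1) → G from x) j = g}) (by simp)]
      refine Finset.sum_congr rfl fun j hj => Finset.sum_congr ?_ fun _ _ => rfl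
      ext i
      simp only [Finset.mem_filter, Finset.mem_univ, true_and] at hj ⊢
      constructor
      · exact fun h => h.2
      · rintro rfl
        exact ⟨hj, rfl⟩))
  exact ⟨⟨fun p => (F p).down, continuous_uliftDown.comp F.continuous⟩,
    fun n x t => congrArg ULift.down (hF n x t)⟩

/-- The action of `G` on `|EG|` is properly discontinuous. -/
lemma exists_nhds_disjoint (p : RealE G) :
    ∃ U ∈ 𝓝 p, ∀ g : G, ((g • ·) '' U ∩ U).Nonempty → g = 1 := by
  classical
  obtain ⟨n, x, t, rfl⟩ := SSet.exists_point (X := EG G) p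
  change Fin (n + 1) → G at x
  obtain ⟨i, hi⟩ : ∃ i, 0 < t i := by
    by_contra! h
    have := Finset.sum_nonpos fun i (_ : i ∈ Finset.univ) => h i
    rw [_root_.stdSimplex.sum_eq_one] at this
    linarith
  set α := _root_.stdSimplex.cumLT t i
  set β := _root_.stdSimplex.cumLE t i
  have hβ : β = t i + α := _root_.stdSimplex.cumLE_eq t i
  have hα : 0 ≤ α := _root_.stdSimplex.cumLT_nonneg t i
  have hβ₁ : β ≤ 1 := _root_.stdSimplex.cumLE_le_one t i
  have hαβ : α ≤ β := _root_.stdSimplex.cumLT_le_cumLE t i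
  have hnonneg {l : ℕ} (u : _root_.stdSimplex ℝ (Fin (l + 1))) (j) :
      0 ≤ _root_.stdSimplex.truncMass u j β - _root_.stdSimplex.truncMass u j α :=
    sub_nonneg.2 (_root_.stdSimplex.truncMass_mono u j hαβ)
  obtain ⟨μ, hμ⟩ := exists_mass α β (x i)
  -- The interval `(α, β]` is the `i`-th step of the given point and has length `t i`. The
  -- neighbourhood consists of the step functions equal to `x i` on more than half of it.
  refine ⟨{q | t i / 2 < μ q}, (isOpen_lt continuous_const μ.continuous).mem_nhds ?_, ?_⟩
  · change t i / 2 < μ (SSet.point (X := EG G) (n := n) x t)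
    rw [hμ]
    refine lt_of_lt_of_le (half_lt_self hi) ?_
    refine le_trans (le_of_eq ?_) (Finset.single_le_sum (fun j _ => hnonneg t j)
      (Finset.mem_filter.2 ⟨Finset.mem_univ i, rfl⟩))
    change _ = (min β β - min α β) - (min β α - min α α)
    rw [min_self, min_self, min_eq_left hαβ, min_eq_right hαβ, hβ]
    ring
  · rintro g ⟨_, ⟨q, hq, rfl⟩, hq'⟩
    obtain ⟨l, y, u, rfl⟩ := SSet.exists_point (X := EG G) q
    change Fin (l + 1) → G at y
    change t i / 2 < μ (SSet.point (X := EG G) (n := l) y u) at hq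
    change t i / 2 < μ (g • SSet.point (X := EG G) (n := l) y u) at hq'
    rw [smul_point] at hq'
    rw [hμ] at hq hq'
    by_contra hg
    -- If `g ≠ 1`, then `q` takes the value `x i` and `g • q` takes it on disjoint sets of steps;
    -- each would fill more than half of `(α, β]`.
    have hdisj : Disjoint ({j | y j = x i} : Finset (Fin (l + 1)))
        ({j | g * y j = x i} : Finset (Fin (l + 1))) := by
      refine Finset.disjoint_left.2 fun j hj hj' => hg ?_
      simp only [Finset.mem_filter, Finset.mem_univ, true_and] at hj hj'
      rw [← hj] at hj'
      exact mul_eq_right.1 hj'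
    have h := Finset.sum_le_univ_sum_of_nonneg (hnonneg u)
      (s := ({j | y j = x i} : Finset (Fin (l + 1))) ∪
        ({j | g * y j = x i} : Finset (Fin (l + 1))))
    rw [Finset.sum_union hdisj, Finset.sum_sub_distrib (s := Finset.univ),
      _root_.stdSimplex.sum_truncMass u (hα.trans hαβ) hβ₁,
      _root_.stdSimplex.sum_truncMass u hα (hαβ.trans hβ₁)] at h
    linarith

lemma isQuotientCoveringMap (H : Subgroup G) :
    IsQuotientCoveringMap (RealEmod.proj H) H where
  toIsQuotientMap := isQuotientMap_quotient_mk'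
  continuous_const_smul h := (SSet.toTop.map (EG.smul (h : G))).hom.continuous
  apply_eq_iff_mem_orbit := Quotient.eq (r := MulAction.orbitRel H (RealE G))
  disjoint p := by
    obtain ⟨U, hU, hU'⟩ := exists_nhds_disjoint p
    exact ⟨U, hU, fun g hg => Subtype.ext (hU' g hg)⟩

end RealE

/-! ### Transport of group operad structures -/

namespace GroupOperad

section Transport

variable {G K L : ℕ → Type*} [∀ n, Group (G n)] [∀ n, Group (K n)] [∀ n, Group (L n)]

lemma ext_of_π_γ {P Q : GroupOperad G} (hπ : ∀ n a, P.π n a = Q.π n a)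
    (hγ : ∀ {k : ℕ} (m : Fin k → ℕ) {N : ℕ} (h : ∑ i, m i = N) (a : G k) (b : ∀ i, G (m i)),
      P.γ m h a b = Q.γ m h a b) : P = Q := by
  obtain ⟨_, π, γ, _, _, _, _, _⟩ := P
  obtain ⟨_, π', γ', _, _, _, _, _⟩ := Q
  obtain rfl : π = π' := funext fun n => MonoidHom.ext (hπ n)
  obtain rfl : @γ = @γ' := by
    funext k m N h a b
    exact hγ m h a b
  rfl

/-- Transport of the structure of a group operad along isomorphisms of groups. -/
def transport (𝒢 : GroupOperad G) (e : ∀ n, G n ≃* K n) : GroupOperad K where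
  subsingleton_zero := have := 𝒢.subsingleton_zero; (e 0).symm.injective.subsingleton
  π n := (𝒢.π n).comp (e n).symm.toMonoidHom
  γ m N h a b := e N (𝒢.γ m h ((e _).symm a) fun i => (e _).symm (b i))
  assoc m M hm n n' hn N hn' hN a b c := by
    simpa using 𝒢.assoc m hm n n' hn hn' hN ((e _).symm a) (fun i => (e _).symm (b i))
      (fun i j => (e _).symm (c i j))
  one_γ h a := by simpa [MulEquiv.eq_symm_apply] using congrArg (e _) (𝒢.one_γ h ((e _).symm a))
  γ_one h a := by simpa using congrArg (e _) (𝒢.γ_one h ((e _).symm a))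
  π_γ m N h a b := by
    simpa using 𝒢.π_γ m h ((e _).symm a) (fun i => (e _).symm (b i))
  crossed m N h a a' b b' := by
    have := congrArg (e N) (𝒢.crossed m h ((e _).symm a) ((e _).symm a')
      (fun i => (e _).symm (b i)) (fun i => (e _).symm (b' i)))
    simp only [map_mul] at this ⊢
    exact this

variable (𝒢 : GroupOperad G) (e : ∀ n, G n ≃* K n)

lemma transport_π (n : ℕ) (a : G n) : (𝒢.transport e).π n (e n a) = 𝒢.π n a := by
  simp [transport]

lemma transport_γ {k : ℕ} (m : Fin k → ℕ) {N : ℕ} (h : ∑ i, m i = N) (a : G k)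
    (b : ∀ i, G (m i)) :
    (𝒢.transport e).γ m h (e k a) (fun i => e (m i) (b i)) = e N (𝒢.γ m h a b) := by
  simp [transport]

variable {𝒢 e} in
lemma eq_transport {P : GroupOperad K} (hπ : ∀ n a, P.π n (e n a) = 𝒢.π n a)
    (hγ : ∀ {k : ℕ} (m : Fin k → ℕ) {N : ℕ} (h : ∑ i, m i = N) (a : G k) (b : ∀ i, G (m i)),
      P.γ m h (e k a) (fun i => e (m i) (b i)) = e N (𝒢.γ m h a b)) : P = 𝒢.transport e := by
  refine ext_of_π_γ (fun n a => ?_) fun m N h a b => ?_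
  · simpa [transport] using hπ n ((e n).symm a)
  · simpa [transport] using hγ m h ((e _).symm a) fun i => (e _).symm (b i)

/-- A group operad is isomorphic to its transports. -/
def transportIso : Iso 𝒢 (𝒢.transport e) where
  app n := (e n).toMonoidHom
  map_π := 𝒢.transport_π e
  map_γ m _ h a b := (𝒢.transport_γ e m h a b).symm
  bijective n := (e n).bijective

/-- The transports of a group operad are isomorphic. -/
def transportTransportIso (e' : ∀ n, G n ≃* L n) : Iso (𝒢.transport e) (𝒢.transport e') where
  app n := ((e n).symm.trans (e' n)).toMonoidHom
  map_π n a := 𝒢.transport_π e' n ((e n).symm a)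
  map_γ m _ h a b := by
    refine Eq.trans ?_ (𝒢.transport_γ e' m h ((e _).symm a) fun i => (e _).symm (b i)).symm
    simp [transport]
  bijective n := ((e n).symm.trans (e' n)).bijective

/-- The composition of isomorphisms of group operads. -/
def Iso.trans {𝒢 : GroupOperad G} {𝒦 : GroupOperad K} {ℒ : GroupOperad L} (f : Iso 𝒢 𝒦)
    (g : Iso 𝒦 ℒ) : Iso 𝒢 ℒ where
  app n := (g.app n).comp (f.app n)
  map_π n a := (g.map_π n _).trans (f.map_π n a)
  map_γ m _ h a b := (congrArg (g.app _) (f.map_γ m h a b)).trans (g.map_γ m h _ _)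
  bijective n := (g.bijective n).comp (f.bijective n)

/-- A group operad is isomorphic to itself as a sub group operad. -/
def wholeIso : Iso 𝒢 (SubGroupOperad.whole 𝒢).toGroupOperad where
  app n := (Subgroup.topEquiv (G := G n)).symm.toMonoidHom
  map_π _ _ := rfl
  map_γ _ _ _ _ _ := rfl
  bijective n := (Subgroup.topEquiv (G := G n)).symm.bijective

end Transport

end GroupOperad

/-! ### The isomorphism `H ≅ π₁(EG/H)` -/

namespace SimplicialPi1

variable {G G' : Type u} [Group G] [Group G'] {H : Subgroup G} {H' : Subgroup G'}

lemma classLabel_ofLift (a : H)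
    (f : (EG G).Edge (EG.base G) ((EG.smul (a : G)).app _ (EG.base G))) :
    classLabel H (ofLift a f) = a := by
  have h₀ : (show Fin 2 → G from f.edge) 0 = 1 := congrFun f.src_eq (0 : Fin 1)
  have h₁ : (show Fin 2 → G from f.edge) 1 = a * 1 := congrFun f.tgt_eq (0 : Fin 1)
  change ((show Fin 2 → G from f.edge) 0)⁻¹ * (show Fin 2 → G from f.edge) 1 = a
  rw [h₀, h₁]
  simp

variable (H) in
/-- The isomorphism `H ≅ π₁(EG/H)`. -/
noncomputable def mulEquiv : H ≃* SimplicialPi1 H :=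
  (MulEquiv.ofBijective (MonoidHom.mk' (fun u => (⟨classLabel H u, classLabel_mem u⟩ : H))
      fun u v => Subtype.ext (classLabel_mul u v))
    ⟨fun _ _ h => classLabel_injective (congrArg Subtype.val h), fun a =>
      (exists_class a.2).imp fun _ h => Subtype.ext h⟩).symm

lemma classLabel_mulEquiv (a : H) : classLabel H (mulEquiv H a) = a :=
  congrArg Subtype.val ((mulEquiv H).symm_apply_apply a)

lemma ofLift_eq (a : H) (f : (EG G).Edge (EG.base G) ((EG.smul (a : G)).app _ (EG.base G))) :
    ofLift a f = mulEquiv H a :=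
  classLabel_injective ((classLabel_ofLift a f).trans (classLabel_mulEquiv a).symm)

lemma map_mulEquiv (φ : G →* G') (hφ : ∀ a ∈ H, φ a ∈ H') (a : H) :
    map φ hφ (mulEquiv H a) = mulEquiv H' ⟨φ a, hφ a a.2⟩ := by
  refine classLabel_injective (Eq.trans ?_ (classLabel_mulEquiv _).symm)
  have key (u : SimplicialPi1 H) : classLabel H' (map φ hφ u) = φ (classLabel H u) := by
    obtain ⟨e⟩ := u
    change label H' ((EGmod.map φ hφ).app _ e.edge) = φ (label H e.edge)
    obtain ⟨s, hs⟩ := Quotient.exists_rep (s := MulAction.orbitRel H (Fin 2 → G)) e.edge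
    rw [← hs]
    change (φ (s 0))⁻¹ * φ (s 1) = φ ((s 0)⁻¹ * s 1)
    simp
  rw [key, classLabel_mulEquiv]

end SimplicialPi1

/-! ### The isomorphism `H ≅ π₁(|EG|/H)` -/

namespace RealPi1

variable {G G' : Type u} [Group G] [Group G'] {H : Subgroup G} {H' : Subgroup G'}

variable (H) in
/-- The isomorphism `H ≅ π₁(|EG|/H)`. -/
noncomputable def mulEquiv : H ≃* RealPi1 H :=
  -- The covering identifies `FundamentalGroup` with `Hᵐᵒᵖ`; the opposite in `RealPi1` cancels this
  -- one.
  ((MulEquiv.op ((RealE.isQuotientCoveringMap H).fundamentalGroupEquiv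
    (x := RealEmod.base H) ⟨RealE.base G, rfl⟩)).trans (MulEquiv.opOp H).symm).symm

/-- The path `f` is itself the lift of the projected loop, so the monodromy moves the base point to
its end point `a e`. -/
lemma ofLift_eq (a : H) (f : Path (RealE.base G) ((a : G) • RealE.base G)) :
    ofLift a f = mulEquiv H a := by
  rw [mulEquiv, MulEquiv.eq_symm_apply]
  have hp := RealE.isQuotientCoveringMap H
  suffices h : hp.fundamentalGroupToMulOpposite (x := RealEmod.base H) ⟨RealE.base G, rfl⟩
      (MulOpposite.unop (ofLift a f)) = MulOpposite.op a from congrArg MulOpposite.unop h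
  rw [IsQuotientCoveringMap.fundamentalGroupToMulOpposite_apply_eq_Iff]
  let e' : RealEmod.proj H ⁻¹' {RealEmod.base H} :=
    ⟨(a : G) • RealE.base G, (RealEmod.proj_smul_base H a).symm⟩
  change (e' : RealE G) = _
  exact congrArg Subtype.val (hp.isCoveringMap.monodromy_eq_of_map_eq (ex := ⟨_, rfl⟩) (ey := e')
    (γ := MulOpposite.unop (ofLift a f)) (Path.Homotopic.Quotient.mk f) rfl).symm

instance (G : Type u) [Group G] (a : G) : Nonempty (Path (RealE.base G) (a • RealE.base G)) :=
  ⟨PathConnectedSpace.somePath _ _⟩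

lemma map_ofLift (φ : G →* G') (hφ : ∀ a ∈ H, φ a ∈ H') (a : H)
    (f : Path (RealE.base G) ((a : G) • RealE.base G)) :
    ∃ f', map φ hφ (ofLift a f) = ofLift ⟨φ a, hφ a a.2⟩ f' := by
  have hb : SSet.toTop.map (EG.map φ) (RealE.base G) = RealE.base G' := by
    refine (SSet.map_point (EG.map φ) (EG.base G) (_root_.stdSimplex.vertex 0)).trans ?_
    refine congrArg (fun s => SSet.point (X := EG G') (n := 0) s (_root_.stdSimplex.vertex 0)) ?_
    exact funext fun _ => map_one φ
  refine ⟨(f.map (SSet.toTop.map (EG.map φ)).hom.continuous).cast hb.symm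
    ((RealE.map_smul φ a _).trans (congrArg _ hb)).symm, congrArg MulOpposite.op ?_⟩
  refine (FundamentalGroup.mapOfEq_apply _ _ _).trans ?_
  rfl

lemma map_mulEquiv (φ : G →* G') (hφ : ∀ a ∈ H, φ a ∈ H') (a : H) :
    map φ hφ (mulEquiv H a) = mulEquiv H' ⟨φ a, hφ a a.2⟩ := by
  obtain ⟨f⟩ : Nonempty (Path (RealE.base G) ((a : G) • RealE.base G)) := inferInstance
  obtain ⟨f', h⟩ := map_ofLift φ hφ a f
  rw [← ofLift_eq a f, h, ofLift_eq]

end RealPi1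

/-! ### Identification of the fundamental groups operads -/

section FundamentalGroupOperads

variable {G : ℕ → Type u} [∀ n, Group (G n)] {𝒢 : GroupOperad G} (𝓗 : SubGroupOperad 𝒢)

namespace GroupOperad

/-- At identities the crossed homomorphism rule reads `x = x * x`. It gives the starting point of
composite lifts. -/
lemma γ_one_one (𝒢 : GroupOperad G) {k : ℕ} (m : Fin k → ℕ) {N : ℕ} (h : ∑ i, m i = N) :
    𝒢.γ m h 1 (fun _ => 1) = 1 := by
  have h' := 𝒢.crossed m h 1 1 (fun _ => 1) (fun _ => 1)
  simp only [mul_one] at h'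
  -- The block sizes in the second factor depend on `π 1`; generalizing it to a variable `p` allows
  -- the substitution `p = 1`.
  have key : ∀ p : SymGroup k, p = 1 →
      𝒢.γ (fun i => m (p.unop.symm i)) (sum_comp_perm h p.unop.symm) 1 (fun _ => 1) =
        𝒢.γ m h 1 (fun _ => 1) := by
    rintro _ rfl
    rfl
  rw [key _ (map_one _)] at h'
  exact (mul_eq_left.1 h'.symm)

end GroupOperad

/-- Since the class of any lift ending at `a e` is `mulEquiv a` and lifts exist for all `a`, the
prescriptions fix `π` and `γ` on all classes. Conversely the entrywise `γ` of lifts is the required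
lift. -/
lemma isSimplicialPi1Operad_iff (P : GroupOperad (fun n => SimplicialPi1 (𝓗.H n))) :
    IsSimplicialPi1Operad 𝓗 P ↔
      P = 𝓗.toGroupOperad.transport fun n => SimplicialPi1.mulEquiv (𝓗.H n) := by
  have hf (n : ℕ) (a : 𝓗.H n) : Nonempty
      ((EG (G n)).Edge (EG.base (G n)) ((EG.smul (a : G n)).app _ (EG.base (G n)))) :=
    ⟨SSet.Edge.mk (X := EG (G n)) (show Fin 2 → G n from ![1, a * 1])
      (funext fun i => by fin_cases i; rfl) (funext fun i => by fin_cases i; rfl)⟩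
  constructor
  · intro hP
    refine GroupOperad.eq_transport (fun n a => ?_) fun m N h a b => ?_
    · rw [← SimplicialPi1.ofLift_eq a (hf n a).some, hP.π_ofLift]
      rfl
    · obtain ⟨w, -, hw⟩ := hP.γ_ofLift m h a b (hf _ a).some fun i => (hf _ (b i)).some
      simpa only [SimplicialPi1.ofLift_eq] using hw
  · rintro rfl
    refine ⟨fun n a f => ?_, fun m N h a b f g => ?_⟩
    · rw [SimplicialPi1.ofLift_eq]
      exact GroupOperad.transport_π _ _ _ _
    · refine ⟨SSet.Edge.mk (𝒢.simplexγ m h f.edge fun i => (g i).edge) ?_ ?_, rfl, ?_⟩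
      · have h₀ : (show Fin 2 → G _ from f.edge) 0 = 1 := congrFun f.src_eq (0 : Fin 1)
        have h₁ (i) : (show Fin 2 → G _ from (g i).edge) 0 = 1 := congrFun (g i).src_eq (0 : Fin 1)
        refine funext fun j : Fin 1 => ?_
        obtain rfl : j = 0 := Subsingleton.elim _ _
        change 𝒢.γ m h ((show Fin 2 → G _ from f.edge) 0)
          (fun i => (show Fin 2 → G _ from (g i).edge) 0) = 1
        rw [h₀, funext h₁]
        exact 𝒢.γ_one_one m h
      · have h₀ : (show Fin 2 → G _ from f.edge) 1 = a * 1 := congrFun f.tgt_eq (0 : Fin 1)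
        have h₁ (i) : (show Fin 2 → G _ from (g i).edge) 1 = b i * 1 :=
          congrFun (g i).tgt_eq (0 : Fin 1)
        refine funext fun j : Fin 1 => ?_
        obtain rfl : j = 0 := Subsingleton.elim _ _
        change 𝒢.γ m h ((show Fin 2 → G _ from f.edge) 1)
          (fun i => (show Fin 2 → G _ from (g i).edge) 1) = 𝒢.γ m h a (fun i => b i) * 1
        rw [h₀, funext h₁]
        simp only [mul_one]
      · simp only [SimplicialPi1.ofLift_eq]
        exact GroupOperad.transport_γ _ _ _ _ _ _

lemma isRealPi1Operad_iff (Q : GroupOperad (fun n => RealPi1 (𝓗.H n))) :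
    IsRealPi1Operad 𝓗 Q ↔ Q = 𝓗.toGroupOperad.transport fun n => RealPi1.mulEquiv (𝓗.H n) := by
  have hw {k : ℕ} (m : Fin k → ℕ) {N : ℕ} (h : ∑ i, m i = N)
      (a : 𝓗.H k) (b : ∀ i, 𝓗.H (m i))
      (f : Path (RealE.base (G k)) ((a : G k) • RealE.base (G k)))
      (g : ∀ i, Path (RealE.base (G (m i))) ((b i : G (m i)) • RealE.base (G (m i)))) :
      ∃ w : Path (RealE.base (G N)) ((𝓗.toGroupOperad.γ m h a b : G N) • RealE.base (G N)),
        ∀ s : I, 𝒢.IsRealγ m h (f s) (fun i => g i s) (w s) := by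
    obtain ⟨w, hw⟩ := 𝒢.exists_path_isRealγ m h (f.cast rfl (RealE.smul_base _).symm)
      fun i => (g i).cast rfl (RealE.smul_base _).symm
    -- The base point is by definition `vertex 1`, so `γ_one_one` corrects the start of the path and
    -- `smul_base` its end.
    exact ⟨w.cast (congrArg RealE.vertex (𝒢.γ_one_one m h)).symm (RealE.smul_base _), hw⟩
  have hf (n : ℕ) (a : 𝓗.H n) : Nonempty (Path (RealE.base (G n)) ((a : G n) • RealE.base (G n))) :=
    inferInstance
  constructor
  · intro hQ
    refine GroupOperad.eq_transport (fun n a => ?_) fun m N h a b => ?_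
    · rw [← RealPi1.ofLift_eq a (hf n a).some, hQ.π_ofLift]
      rfl
    · obtain ⟨w, -, hw⟩ := hQ.γ_ofLift m h a b (hf _ a).some fun i => (hf _ (b i)).some
      simpa only [RealPi1.ofLift_eq] using hw
  · rintro rfl
    refine ⟨fun n a f => ?_, fun m N h a b f g => ?_⟩
    · rw [RealPi1.ofLift_eq]
      exact GroupOperad.transport_π _ _ _ _
    · obtain ⟨w, hw⟩ := hw m h a b f g
      refine ⟨w, hw, ?_⟩
      simp only [RealPi1.ofLift_eq]
      exact GroupOperad.transport_γ _ _ _ _ _ _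

end FundamentalGroupOperads

end

theorem mainTheorem4 :
    -- the fundamental groups operads `π₁(E𝒢/𝓗)` and `π₁(|E𝒢|/𝓗)`
    ∃ (P : ∀ {G : ℕ → Type u} [∀ n, Group (G n)] {𝒢 : GroupOperad G} (𝓗 : SubGroupOperad 𝒢),
          GroupOperad (fun n => SimplicialPi1 (𝓗.H n)))
      (Q : ∀ {G : ℕ → Type u} [∀ n, Group (G n)] {𝒢 : GroupOperad G} (𝓗 : SubGroupOperad 𝒢),
          GroupOperad (fun n => RealPi1 (𝓗.H n))),
      (∀ {G : ℕ → Type u} [∀ n, Group (G n)] {𝒢 : GroupOperad G} (𝓗 : SubGroupOperad 𝒢),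
        (∀ P', IsSimplicialPi1Operad 𝓗 P' ↔ P' = P 𝓗) ∧
        (∀ Q', IsRealPi1Operad 𝓗 Q' ↔ Q' = Q 𝓗)) ∧
      -- the isomorphisms `𝓗 ≅ π₁(E𝒢/𝓗) ≅ π₁(|E𝒢|/𝓗)`
      (∃ (Φ : ∀ {G : ℕ → Type u} [∀ n, Group (G n)] {𝒢 : GroupOperad G} (𝓗 : SubGroupOperad 𝒢),
            GroupOperad.Iso 𝓗.toGroupOperad (P 𝓗))
        (Ψ : ∀ {G : ℕ → Type u} [∀ n, Group (G n)] {𝒢 : GroupOperad G} (𝓗 : SubGroupOperad 𝒢),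
            GroupOperad.Iso (P 𝓗) (Q 𝓗)),
        -- naturality in the pair `(𝒢, 𝓗)`
        ∀ {G : ℕ → Type u} [∀ n, Group (G n)] {𝒢 : GroupOperad G} (𝓗 : SubGroupOperad 𝒢)
          {G' : ℕ → Type u} [∀ n, Group (G' n)] {𝒢' : GroupOperad G'} (𝓗' : SubGroupOperad 𝒢')
          (ψ : GroupOperad.Hom 𝒢 𝒢') (hψ : ψ.MapsPair 𝓗 𝓗') (n : ℕ),
          (∀ a : 𝓗.H n,
            SimplicialPi1.map (ψ.app n) (hψ n) ((Φ 𝓗).app n a) =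
              (Φ 𝓗').app n ⟨ψ.app n a, hψ n a a.2⟩) ∧
          (∀ x : SimplicialPi1 (𝓗.H n),
            RealPi1.map (ψ.app n) (hψ n) ((Ψ 𝓗).app n x) =
              (Ψ 𝓗').app n (SimplicialPi1.map (ψ.app n) (hψ n) x))) ∧
      -- the case `𝓗 = 𝒢`
      (∀ {G : ℕ → Type u} [∀ n, Group (G n)] (𝒢 : GroupOperad G),
        Nonempty (GroupOperad.Iso 𝒢 (P (SubGroupOperad.whole 𝒢))) ∧
        Nonempty (GroupOperad.Iso (P (SubGroupOperad.whole 𝒢)) (Q (SubGroupOperad.whole 𝒢))) ∧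
        Nonempty (GroupOperad.Iso 𝒢 (Q (SubGroupOperad.whole 𝒢)))) := by
  refine ⟨fun 𝓗 => 𝓗.toGroupOperad.transport fun n => SimplicialPi1.mulEquiv (𝓗.H n),
    fun 𝓗 => 𝓗.toGroupOperad.transport fun n => RealPi1.mulEquiv (𝓗.H n),
    fun 𝓗 => ⟨isSimplicialPi1Operad_iff 𝓗, isRealPi1Operad_iff 𝓗⟩,
    ⟨fun 𝓗 => GroupOperad.transportIso _ _, fun 𝓗 => GroupOperad.transportTransportIso _ _ _,
      fun 𝓗 _ _ _ 𝓗' ψ hψ n => ⟨SimplicialPi1.map_mulEquiv _ _, fun x => ?_⟩⟩,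
    fun 𝒢 => ⟨⟨𝒢.wholeIso.trans (GroupOperad.transportIso _ _)⟩,
      ⟨GroupOperad.transportTransportIso _ _ _⟩,
      ⟨𝒢.wholeIso.trans (GroupOperad.transportIso _ _)⟩⟩⟩
  -- The second isomorphism passes through `H`, so its naturality follows from that of the two
  -- identifications with `H`.
  obtain ⟨a, rfl⟩ := (SimplicialPi1.mulEquiv (𝓗.H n)).surjective x
  rw [SimplicialPi1.map_mulEquiv]
  simp only [GroupOperad.transportTransportIso, MulEquiv.toMonoidHom_eq_coe, MonoidHom.coe_coe,
    MulEquiv.trans_apply, MulEquiv.symm_apply_apply]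
  exact RealPi1.map_mulEquiv _ _ a
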